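/- **Theorem (matched-pair estimands).** Let $Q$ be the law of $W=(Y(1),Y(0),R(1),R(0),X)$, where $Y(d)$ are real potential outcomes, $R(d)\in\{0,1\}$ are potential response (non-attrition) indicators, and $X\in\mathbb R^k$ are covariates. For every even sample size $n$ let $W_1,\dots,W_n$ be i.i.d. with law $Q$, write $X^{(n)}=(X_1,\dots,X_n)$ (and similarly for other variables), let $\pi=\pi_n(X^{(n)})$ be a permutation of $\{1,\dots,n\}$ depending (measurably) on $X^{(n)}$, and let units $\pi(2j-1),\pi(2j)$ form the $j$-th pair, $1\le j\le n/2$. With treatments $D_i\in\{0,1\}$ one observes $D_i$, $R_i=R_i(1)D_i+R_i(0)(1-D_i)$ and $Y_i=(Y_i(1)D_i+Y_i(0)(1-D_i))R_i$. Assume: 1. $E|Y(d)|<\infty$ and $E[R(d)]>0$ for $d\in\{0,1\}$; 2. for $d\in\{0,1\}$, $x\mapsto E[R(d)\mid X=x]$ and $x\mapsto E[Y(d)R(d)\mid X=x]$ are Lipschitz (have Lipschitz versions); 3. $(Y^{(n)}(1),Y^{(n)}(0),R^{(n)}(1),R^{(n)}(0))$ is independent of $D^{(n)}$ conditionally on $X^{(n)}$,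 and conditionally on $X^{(n)}$ the vectors $(D_{\pi(2j-1)},D_{\pi(2j)})$, $1\le j\le n/2$, are i.i.d. uniform on $\{(0,1),(1,0)\}$; 4. $\frac1n\sum_{1\le j\le n/2}|X_{\pi(2j-1)}-X_{\pi(2j)}|\to 0$ in probability. Put $$\hat\theta_n=\frac{\sum_{i\le n} Y_iR_iD_i}{\sum_{i\le n} R_iD_i}-\frac{\sum_{i\le n} Y_iR_i(1-D_i)}{\sum_{i\le n} R_i(1-D_i)},$$ $$\hat\theta_n^{\rm drop}=\frac{\sum_{j\le n/2}R_{\pi(2j-1)}R_{\pi(2j)}(Y_{\pi(2j-1)}-Y_{\pi(2j)})(D_{\pi(2j-1)}-D_{\pi(2j)})}{\sum_{j\le n/2}R_{\pi(2j-1)}R_{\pi(2j)}}$$ (with an arbitrary fixed convention, here $0$, for a quotient by zero). Then, as $n\to\infty$ along even $n$: * $\hat\theta_n\to\theta^{\rm obs}$ in probability, where $$\theta^{\rm obs}=\frac{E[R(1)Y(1)]}{E[R(1)]}-\frac{E[R(0)Y(0)]}{E[R(0)]}=E[Y(1)\mid R(1)=1]-E[Y(0)\mid R(0)=1].$$ *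 For every even $n$, almost surely, if at least one pair has $R_{\pi(2j-1)}=R_{\pi(2j)}=1$, then $\hat\theta_n^{\rm drop}$ is the unique ordinary least squares coefficient on $D_i$ in the regression of $Y_i$ on $D_i$ and pair fixed effects over the units with $R_i=1$. * If $E\big[E[R(1)\mid X]\,E[R(0)\mid X]\big]>0$, then $\hat\theta_n^{\rm drop}\to\theta^{\rm drop}$ in probability, where $$\theta^{\rm drop}=\frac{E\big[E[Y(1)R(1)\mid X]\,E[R(0)\mid X]\big]-E\big[E[Y(0)R(0)\mid X]\,E[R(1)\mid X]\big]}{E\big[E[R(1)\mid X]\,E[R(0)\mid X]\big]},$$ and so does every (choice of) ordinary least squares coefficient on $D_i$ in the regression with pair fixed effects. -/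

import Mathlib

open MeasureTheory ProbabilityTheory Filter Topology
open scoped NNReal

noncomputable section

namespace MatchedPair

/-! ## The population -/

/-- The variables of one unit: the potential outcomes `(Y(d))_d`, the potential response indicators
`(R(d))_d` and the covariate vector `X`; treatment `true` is `d = 1`, control `false` is `d = 0`. -/
abbrev UnitData (k : ℕ) : Type :=
  (Bool → ℝ) × (Bool → Bool) × EuclideanSpace ℝ (Fin k)

/-- The number `1` for `true` and `0` for `false`. -/
def ind (b : Bool) : ℝ := if b then 1 else 0

/-- The potential outcome `Y(d)`. -/
def potY {k : ℕ} (d : Bool) (w : UnitData k) : ℝ := w.1 d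

/-- The potential response indicator `R(d)`, as a number in `{0, 1}`. -/
def potR {k : ℕ} (d : Bool) (w : UnitData k) : ℝ := ind (w.2.1 d)

/-- The product `Y(d) R(d)`. -/
def potYR {k : ℕ} (d : Bool) (w : UnitData k) : ℝ := potY d w * potR d w

/-- The covariates `X`. -/
def covX {k : ℕ} (w : UnitData k) : EuclideanSpace ℝ (Fin k) := w.2.2

/-- The conditional expectation `E[f | X]` under the law `Q` of one unit. -/
def condX {k : ℕ} (Q : Measure (UnitData k)) (f : UnitData k → ℝ) : UnitData k → ℝ :=
  Q[f | MeasurableSpace.comap covX inferInstance]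

/-- `E[f | X = x]` is Lipschitz in `x`: it has a version that is Lipschitz. -/
def HasLipschitzCondMean {k : ℕ} (Q : Measure (UnitData k)) (f : UnitData k → ℝ) : Prop :=
  ∃ (K : ℝ≥0) (g : EuclideanSpace ℝ (Fin k) → ℝ),
    LipschitzWith K g ∧ condX Q f =ᵐ[Q] fun w => g (covX w)

/-- `θ^obs` as the difference of the ratios `E[R(d) Y(d)] / E[R(d)]`. -/
def thetaObs {k : ℕ} (Q : Measure (UnitData k)) : ℝ :=
  (∫ w, potR true w * potY true w ∂Q) / (∫ w, potR true w ∂Q)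
    - (∫ w, potR false w * potY false w ∂Q) / (∫ w, potR false w ∂Q)

/-- `E[Y(d) | R(d) = 1]`, the mean of `Y(d)` under `Q` conditioned on the event `R(d) = 1`. -/
def meanGivenResponse {k : ℕ} (Q : Measure (UnitData k)) (d : Bool) : ℝ :=
  ∫ w, potY d w ∂(ProbabilityTheory.cond Q {w | potR d w = 1})

/-- `E[E[R(1) | X] E[R(0) | X]]`, the denominator of `θ^drop`. -/
def dropDenom {k : ℕ} (Q : Measure (UnitData k)) : ℝ :=
  ∫ w, condX Q (potR true) w * condX Q (potR false) w ∂Q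

/-- The estimand `θ^drop`. -/
def thetaDrop {k : ℕ} (Q : Measure (UnitData k)) : ℝ :=
  ((∫ w, condX Q (potYR true) w * condX Q (potR false) w ∂Q)
    - ∫ w, condX Q (potYR false) w * condX Q (potR true) w ∂Q) / dropDenom Q

/-! ## Observed data -/

/-- The observed response indicator `R = R(1) D + R(0) (1 - D)`. -/
def obsR {k : ℕ} (w : UnitData k) (d : Bool) : ℝ :=
  potR true w * ind d + potR false w * (1 - ind d)

/-- The observed outcome `Y = Y* R`, where `Y* = Y(1) D + Y(0) (1 - D)`. -/
def obsY {k : ℕ} (w : UnitData k) (d : Bool) : ℝ :=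
  (potY true w * ind d + potY false w * (1 - ind d)) * obsR w d

/-! ## Estimators, as functions of observed data `(Y_i, R_i, D_i)` and of the pairing -/

/-- Position of the first member of the `j`-th pair in the list `π(1), …, π(2m)`. -/
def fstPos {m : ℕ} (j : Fin m) : Fin (2 * m) := ⟨2 * j.val, by omega⟩

/-- Position of the second member of the `j`-th pair in the list `π(1), …, π(2m)`. -/
def sndPos {m : ℕ} (j : Fin m) : Fin (2 * m) := ⟨2 * j.val + 1, by omega⟩

/-- The difference-in-means estimator on non-attritors. -/
def diffInMeans {n : ℕ} (Y R D : Fin n → ℝ) : ℝ :=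
  (∑ i, Y i * R i * D i) / (∑ i, R i * D i)
    - (∑ i, Y i * R i * (1 - D i)) / (∑ i, R i * (1 - D i))

/-- The number of pairs without an attritor. -/
def completePairs {m : ℕ} (π : Equiv.Perm (Fin (2 * m))) (R : Fin (2 * m) → ℝ) : ℝ :=
  ∑ j : Fin m, R (π (fstPos j)) * R (π (sndPos j))

/-- The estimator that drops every pair with an attritor. -/
def dropPairs {m : ℕ} (π : Equiv.Perm (Fin (2 * m))) (Y R D : Fin (2 * m) → ℝ) : ℝ :=
  (completePairs π R)⁻¹ *
    ∑ j : Fin m, R (π (fstPos j)) * R (π (sndPos j))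
      * (Y (π (fstPos j)) - Y (π (sndPos j))) * (D (π (fstPos j)) - D (π (sndPos j)))

/-- Residual sum of squares, over the units with `R i = 1`, of the regression of `Y` on `D` and
pair fixed effects, at the coefficient `b` of `D` and the fixed effects `δ`. -/
def pairFERss {m : ℕ} (π : Equiv.Perm (Fin (2 * m))) (Y R D : Fin (2 * m) → ℝ)
    (b : ℝ) (δ : Fin m → ℝ) : ℝ :=
  ∑ i, if R i = 1 then
    (Y i - b * D i
      - ∑ j : Fin m, δ j * (if i = π (fstPos j) ∨ i = π (sndPos j) then 1 else 0)) ^ 2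
  else 0

/-- `b` is an ordinary least squares coefficient of `D` in the regression of `Y` on `D` and pair
fixed effects on the non-attritors: it is part of a minimizer of the residual sum of squares. -/
def IsPairFECoefficient {m : ℕ} (π : Equiv.Perm (Fin (2 * m))) (Y R D : Fin (2 * m) → ℝ)
    (b : ℝ) : Prop :=
  ∃ δ : Fin m → ℝ, ∀ (b' : ℝ) (δ' : Fin m → ℝ),
    pairFERss π Y R D b δ ≤ pairFERss π Y R D b' δ'

/-! ## Sampling and treatment assignment -/

/-- Conditional independence of `f` and `g` given the σ-algebra `m'`:
`P(f ∈ A, g ∈ B | m') = P(f ∈ A | m') P(g ∈ B | m')` almost surely, for all measurable `A`, `B`.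
(Stated through conditional expectations, so that no regularity of `Ω` is needed.) -/
def CondIndepGiven {Ω β γ : Type*} [MeasurableSpace β] [MeasurableSpace γ]
    (m' : MeasurableSpace Ω) {mΩ : MeasurableSpace Ω} (f : Ω → β) (g : Ω → γ) (μ : Measure Ω) : Prop :=
  ∀ (A : Set β) (B : Set γ), MeasurableSet A → MeasurableSet B →
    μ[(f ⁻¹' A ∩ g ⁻¹' B).indicator (fun _ => (1 : ℝ)) | m']
      =ᵐ[μ] μ[(f ⁻¹' A).indicator (fun _ => (1 : ℝ)) | m']
        * μ[(g ⁻¹' B).indicator (fun _ => (1 : ℝ)) | m']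

/-- Conditionally on `m'`, the variables `Z_j` are i.i.d. with the (nonrandom) law `ν`:
`P(Z_j ∈ A_j for all j | m') = ∏_j ν(A_j)` almost surely, for all measurable `A_j`. -/
def CondIIDGiven {Ω ι β : Type*} [Fintype ι] [MeasurableSpace β]
    (m' : MeasurableSpace Ω) {mΩ : MeasurableSpace Ω} (Z : ι → Ω → β) (ν : Measure β) (μ : Measure Ω) : Prop :=
  ∀ A : ι → Set β, (∀ j, MeasurableSet (A j)) →
    μ[(⋂ j, Z j ⁻¹' A j).indicator (fun _ => (1 : ℝ)) | m'] =ᵐ[μ] fun _ => ∏ j, ν.real (A j)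

/-- The vector `X^(n)` of the covariates of a sample of `n` units. -/
def covVec {Ω : Type*} {k n : ℕ} (W : Fin n → Ω → UnitData k) (ω : Ω) :
    Fin n → EuclideanSpace ℝ (Fin k) :=
  fun i => covX (W i ω)

/-- The σ-algebra generated by `X^(n)`. -/
abbrev sigmaX {Ω : Type*} {k n : ℕ} (W : Fin n → Ω → UnitData k) : MeasurableSpace Ω :=
  MeasurableSpace.comap (covVec W) inferInstance

/-- The uniform distribution on `{(0, 1), (1, 0)}`. -/
def fairPair : Measure (Bool × Bool) :=
  uniformOn {(false, true), (true, false)}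

/-- Matched-pair assignment in a sample of `2m` units, paired by a permutation `π(X^(2m))`:
given `X^(2m)`, the treatments are independent of the potential outcomes and responses, and the
treatments of the `m` pairs are i.i.d. uniform on `{(0, 1), (1, 0)}`. -/
structure IsMatchedPairAssignment {Ω : Type*} {mΩ : MeasurableSpace Ω} {k m : ℕ}
    (π : (Fin (2 * m) → EuclideanSpace ℝ (Fin k)) → Equiv.Perm (Fin (2 * m)))
    (W : Fin (2 * m) → Ω → UnitData k) (D : Fin (2 * m) → Ω → Bool) (μ : Measure Ω) : Prop where
  condIndep : CondIndepGiven (sigmaX W)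
    (fun ω (i : Fin (2 * m)) => ((W i ω).1, (W i ω).2.1)) (fun ω i => D i ω) μ
  condIID : CondIIDGiven (sigmaX W)
    (fun (j : Fin m) ω =>
      (D (π (covVec W ω) (fstPos j)) ω, D (π (covVec W ω) (sndPos j)) ω)) fairPair μ

/-- The normalized total distance `(1/n) ∑_j |X_{π(2j-1)} - X_{π(2j)}|` within the pairs, for
`n = 2m` units. -/
def avgPairDistance {Ω : Type*} {k m : ℕ}
    (π : (Fin (2 * m) → EuclideanSpace ℝ (Fin k)) → Equiv.Perm (Fin (2 * m)))
    (W : Fin (2 * m) → Ω → UnitData k) (ω : Ω) : ℝ :=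
  (1 / ((2 * m : ℕ) : ℝ)) * ∑ j : Fin m,
    ‖covX (W (π (covVec W ω) (fstPos j)) ω) - covX (W (π (covVec W ω) (sndPos j)) ω)‖

/-- The observed outcomes of a sample. -/
def sampleY {Ω : Type*} {k n : ℕ} (W : Fin n → Ω → UnitData k)
    (D : Fin n → Ω → Bool) (ω : Ω) : Fin n → ℝ :=
  fun i => obsY (W i ω) (D i ω)

/-- The observed response indicators of a sample. -/
def sampleR {Ω : Type*} {k n : ℕ} (W : Fin n → Ω → UnitData k)
    (D : Fin n → Ω → Bool) (ω : Ω) : Fin n → ℝ :=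
  fun i => obsR (W i ω) (D i ω)

/-- The treatment indicators of a sample, as numbers. -/
def sampleD {Ω : Type*} {n : ℕ} (D : Fin n → Ω → Bool) (ω : Ω) : Fin n → ℝ :=
  fun i => ind (D i ω)

end MatchedPair

end

/-! Given the covariates, the pair treatments are independent of the potential outcomes and
responses, and their conditional law does not depend on the covariates. Hence they are independent
of the whole sample (`indepFun_pairTreatment`). The data are then distributed as `Q^(2m) ⊗ ν`, with
`ν` the law of `m` independent fair coins (`map_sample_prodMk`), and each estimator becomes a ratio
of sums over pairs of functions of the treated unit `pick π true` and the control unit `pick π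
false`.

Three averages carry the limits. (a) The mean over all units obeys the law of large numbers. (b) The
mean over pairs of treated minus control carries centered coin signs that are independent of the
data, so its terms are orthogonal. Combining (a) and (b) gives the average over one arm, hence
`θ^obs`. (c) For a product `f h` across a pair, write `f h - E[f|X] E[h|X] = (f - E[f|X]) h + (h -
E[h|X]) E[f|X]`. The pairing sees only covariates, so a centered factor is orthogonal to everything
that involves its unit only through `X` (`integral_unit_mul_eq_zero`), and the sums are again
orthogonal. What remains is `E[f|X]` at one unit times `E[h|X]` at its partner. The Lipschitz
property moves the first factor to the partner at a cost proportional to the mean pair distance, and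
the one-arm average applies to `E[f|X] E[h|X]`.

Orthogonality gives a first absolute moment of order `1/√m`, but only for bounded functions. Since
`Y(d)` has just a first moment, the general case follows by density in `L¹`
(`tendsto_zero_of_tendsto_zero_bounded`).

In the regression, a pair with an attritor is fitted exactly by its own effect. The complete pairs
leave a quadratic in `b` whose vertex is the drop-pairs estimator. The fraction of complete pairs
tends to `dropDenom Q`; if this is positive, the event of having none is asymptotically negligible.
-/

namespace MatchedPair

/-! ## Convergence in measure and in mean -/

section General

variable {Ω : Type*} [MeasurableSpace Ω]

/-- Continuous mapping, for a pair of sequences converging in measure to constants. -/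
lemma tendstoInMeasure_comp₂ {μ : Measure Ω} {f g : ℕ → Ω → ℝ} {a b : ℝ} {F : ℝ → ℝ → ℝ}
    (hF : ContinuousAt (fun p : ℝ × ℝ => F p.1 p.2) (a, b))
    (hf : TendstoInMeasure μ f atTop (fun _ => a))
    (hg : TendstoInMeasure μ g atTop (fun _ => b)) :
    TendstoInMeasure μ (fun m ω => F (f m ω) (g m ω)) atTop (fun _ => F a b) := by
  rw [tendstoInMeasure_iff_dist] at hf hg ⊢
  intro ε hε
  obtain ⟨δ, hδ, h⟩ := Metric.continuousAt_iff.1 hF ε hε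
  have hsum := (hf δ hδ).add (hg δ hδ)
  rw [add_zero] at hsum
  refine tendsto_of_tendsto_of_tendsto_of_le_of_le tendsto_const_nhds hsum
    (fun _ => zero_le) fun m => ?_
  refine (measure_mono fun ω hω => ?_).trans (measure_union_le _ _)
  by_contra hcon
  simp only [Set.mem_union, Set.mem_ofPred_eq, not_or, not_le] at hcon
  exact absurd (h (x := (f m ω, g m ω)) (by rw [Prod.dist_eq]; exact max_lt hcon.1 hcon.2))
    (not_lt.2 hω)

lemma tendstoInMeasure_of_tendsto_integral_abs {μ : Measure Ω} {f : ℕ → Ω → ℝ}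
    (hint : ∀ m, Integrable (f m) μ)
    (h : Tendsto (fun m => ∫ ω, |f m ω| ∂μ) atTop (𝓝 0)) :
    TendstoInMeasure μ f atTop (fun _ => 0) := by
  refine tendstoInMeasure_of_tendsto_eLpNorm (p := 1) one_ne_zero
    (fun m => (hint m).aestronglyMeasurable) aestronglyMeasurable_const ?_
  have : ∀ m, eLpNorm (f m - fun _ => (0 : ℝ)) 1 μ = ENNReal.ofReal (∫ ω, |f m ω| ∂μ) := by
    intro m
    have : f m - (fun _ => (0 : ℝ)) = f m := by ext; simp
    rw [this, eLpNorm_one_eq_lintegral_enorm, ← ofReal_integral_norm_eq_lintegral_enorm (hint m)]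
    rfl
  simp_rw [this]
  simpa using (ENNReal.tendsto_ofReal h)

/-- A sequence that is dominated by one converging to zero in measure converges to zero. -/
lemma tendstoInMeasure_zero_of_abs_le {μ : Measure Ω} {f g : ℕ → Ω → ℝ}
    (hg : TendstoInMeasure μ g atTop (fun _ => 0)) (h : ∀ m, ∀ᵐ ω ∂μ, |f m ω| ≤ g m ω) :
    TendstoInMeasure μ f atTop (fun _ => 0) := by
  rw [tendstoInMeasure_iff_dist] at hg ⊢
  intro ε hε
  refine tendsto_of_tendsto_of_tendsto_of_le_of_le tendsto_const_nhds (hg ε hε)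
    (fun _ => zero_le) fun m => ?_
  refine measure_mono_ae ?_
  filter_upwards [h m] with ω hω hle
  have hle' : ε ≤ dist (f m ω) 0 := hle
  change ε ≤ dist (g m ω) 0
  rw [Real.dist_eq, sub_zero] at hle' ⊢
  exact hle'.trans (hω.trans (le_abs_self _))

/-- This is nonnegativity of the variance of `|f|`. -/
lemma integral_abs_le_sqrt_integral_sq {μ : Measure Ω} [IsProbabilityMeasure μ] {f : Ω → ℝ}
    (hf : MemLp f 2 μ) : ∫ ω, |f ω| ∂μ ≤ √(∫ ω, f ω ^ 2 ∂μ) := by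
  refine Real.le_sqrt_of_sq_le ?_
  have hv := variance_nonneg (fun ω => |f ω|) μ
  rw [variance_eq_sub (by simpa using hf.norm)] at hv
  simpa using hv

/-- The mean of bounded orthogonal variables is small in mean. -/
lemma integral_abs_mean_le_of_orthogonal {ι : Type*} [Fintype ι] {μ : Measure Ω}
    [IsProbabilityMeasure μ] {ψ : ι → Ω → ℝ} {C : ℝ} (hC : 0 ≤ C)
    (hψ : ∀ j, AEStronglyMeasurable (ψ j) μ) (hb : ∀ j, ∀ᵐ ω ∂μ, |ψ j ω| ≤ C)
    (ho : ∀ j j', j ≠ j' → ∫ ω, ψ j ω * ψ j' ω ∂μ = 0) :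
    ∫ ω, |(Fintype.card ι : ℝ)⁻¹ * ∑ j, ψ j ω| ∂μ ≤ C / √(Fintype.card ι) := by
  classical
  have hL : ∀ j, MemLp (ψ j) 2 μ := fun j => MemLp.of_bound (hψ j) C (by simpa using hb j)
  have hLL : ∀ j j', Integrable (fun ω => ψ j ω * ψ j' ω) μ :=
    fun j j' => (hL j).integrable_mul (hL j')
  have hS : MemLp (fun ω => ∑ j, ψ j ω) 2 μ := memLp_finsetSum _ fun j _ => hL j
  have hsq : ∫ ω, (∑ j, ψ j ω) ^ 2 ∂μ ≤ Fintype.card ι * C ^ 2 := by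
    have h1 : ∫ ω, (∑ j, ψ j ω) ^ 2 ∂μ = ∑ j, ∑ j', ∫ ω, ψ j ω * ψ j' ω ∂μ := by
      simp_rw [sq, Finset.sum_mul_sum]
      rw [integral_finsetSum _ fun j _ => integrable_finsetSum _ fun j' _ =>
        hLL j j']
      refine Finset.sum_congr rfl fun j _ => ?_
      rw [integral_finsetSum _ fun j' _ => hLL j j']
    rw [h1]
    -- Orthogonality leaves only the diagonal term of each row.
    have h2 : ∀ j, ∑ j', ∫ ω, ψ j ω * ψ j' ω ∂μ ≤ C ^ 2 := by
      intro j
      rw [Finset.sum_eq_single j (fun j' _ hj => ho j j' hj.symm) (by simp)]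
      have : ∫ ω, ψ j ω * ψ j ω ∂μ ≤ ∫ _, C ^ 2 ∂μ := by
        refine integral_mono_ae (hLL j j) (integrable_const _) ?_
        filter_upwards [hb j] with ω hω
        rw [← sq, ← sq_abs]
        exact pow_le_pow_left₀ (abs_nonneg _) hω 2
      simpa using this
    calc _ ≤ ∑ _ : ι, C ^ 2 := Finset.sum_le_sum fun j _ => h2 j
      _ = _ := by simp
  simp_rw [abs_mul]
  rw [integral_const_mul, abs_of_nonneg (by positivity)]
  have h3 : ∫ ω, |∑ j, ψ j ω| ∂μ ≤ √(Fintype.card ι) * C :=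
    (integral_abs_le_sqrt_integral_sq hS).trans
      ((Real.sqrt_le_sqrt hsq).trans (by rw [Real.sqrt_mul (by positivity), Real.sqrt_sq hC]))
  rcases Nat.eq_zero_or_pos (Fintype.card ι) with h0 | h0
  · simp [h0]
  · have hs : 0 < √(Fintype.card ι : ℝ) := Real.sqrt_pos.2 (by exact_mod_cast h0)
    calc _ ≤ (Fintype.card ι : ℝ)⁻¹ * (√(Fintype.card ι) * C) := by gcongr
      _ = _ := by
        rw [inv_mul_eq_div, div_eq_div_iff (by positivity) hs.ne']
        nlinarith [Real.mul_self_sqrt (Nat.cast_nonneg (α := ℝ) (Fintype.card ι))]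

/-- A sequence of functionals that is uniformly continuous in mean tends to zero at every
integrable function if it does so at the bounded ones. -/
lemma tendsto_zero_of_tendsto_zero_bounded {Q : Measure Ω} {N : ℕ → (Ω → ℝ) → ℝ} {c : ℝ}
    (hN : ∀ m q, 0 ≤ N m q)
    (hbdd : ∀ q, Measurable q → ∀ C : ℝ, (∀ w, |q w| ≤ C) → Integrable q Q →
      Tendsto (fun m => N m q) atTop (𝓝 0))
    (hLip : ∀ m q q', Integrable q Q → Integrable q' Q →
      N m q ≤ N m q' + c * ∫ w, |q w - q' w| ∂Q)
    {q : Ω → ℝ} (hq : Integrable q Q) : Tendsto (fun m => N m q) atTop (𝓝 0) := by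
  rw [Metric.tendsto_atTop]
  intro ε hε
  -- A simple function is bounded. The denominator uses `|c| + 1` so that it is positive whatever
  -- `c` is.
  obtain ⟨g, hg, hgL⟩ := (memLp_one_iff_integrable.2 hq).exists_simpleFunc_eLpNorm_sub_lt
    (by simp) (ε := ENNReal.ofReal (ε / (2 * (|c| + 1)))) (by simpa using by positivity)
  have hgi : Integrable g Q := memLp_one_iff_integrable.1 hgL
  have hclose : ∫ w, |q w - g w| ∂Q < ε / (2 * (|c| + 1)) := by
    rw [eLpNorm_one_eq_lintegral_enorm,
      ← ofReal_integral_norm_eq_lintegral_enorm (hq.sub hgi)] at hg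
    exact (ENNReal.ofReal_lt_ofReal_iff (by positivity)).1 hg
  obtain ⟨C, hC⟩ := g.exists_forall_norm_le
  have ht := hbdd g g.measurable C hC hgi
  rw [Metric.tendsto_atTop] at ht
  obtain ⟨M, hM⟩ := ht (ε / 2) (by positivity)
  refine ⟨M, fun m hm => ?_⟩
  have h1 := hM m hm
  rw [Real.dist_eq, sub_zero, abs_of_nonneg (hN _ _)] at h1 ⊢
  have h2 := hLip m q g hq hgi
  have h0 : 0 ≤ ∫ w, |q w - g w| ∂Q := integral_nonneg fun _ => abs_nonneg _
  have h3 : c * ∫ w, |q w - g w| ∂Q ≤ ε / 2 := by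
    calc c * ∫ w, |q w - g w| ∂Q ≤ (|c| + 1) * ∫ w, |q w - g w| ∂Q := by
          gcongr; linarith [le_abs_self c]
      _ ≤ (|c| + 1) * (ε / (2 * (|c| + 1))) := by gcongr
      _ = ε / 2 := by field_simp
  linarith

/-- Resampling one coordinate of a product measure. -/
lemma measurePreserving_update {ι : Type*} [Fintype ι] [DecidableEq ι] (Q : Measure Ω)
    [IsProbabilityMeasure Q] (i : ι) :
    MeasurePreserving (fun p : (ι → Ω) × Ω => Function.update p.1 i p.2)
      ((Measure.pi fun _ : ι => Q).prod Q) (Measure.pi fun _ : ι => Q) := by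
  have hm : Measurable (fun p : (ι → Ω) × Ω => Function.update p.1 i p.2) := by
    refine measurable_pi_lambda _ fun j => ?_
    by_cases hj : j = i
    · subst hj; simpa using measurable_snd
    · simp only [Function.update_of_ne hj]; fun_prop
  refine ⟨hm, (Measure.pi_eq fun s hs => ?_).symm⟩
  rw [Measure.map_apply hm (MeasurableSet.univ_pi hs)]
  have : (fun p : (ι → Ω) × Ω => Function.update p.1 i p.2) ⁻¹' (Set.univ.pi s)
      = (Set.univ.pi (Function.update s i Set.univ)) ×ˢ s i := by
    ext ⟨w, a⟩
    simp only [Set.mem_preimage, Set.mem_pi, Set.mem_univ, true_implies, Set.mem_prod]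
    constructor
    · intro h
      refine ⟨fun j => ?_, by simpa using h i⟩
      by_cases hj : j = i
      · subst hj; simp
      · simpa [Function.update_of_ne hj] using h j
    · rintro ⟨h, ha⟩ j
      by_cases hj : j = i
      · subst hj; simpa using ha
      · simpa [Function.update_of_ne hj] using h j
  -- The old coordinate `i` is unconstrained and contributes 1; the factor `Q (s i)` comes from the
  -- fresh draw.
  rw [this, Measure.prod_prod, Measure.pi_pi, ← Finset.mul_prod_erase _ _ (Finset.mem_univ i),
    ← Finset.mul_prod_erase (a := i) _ (fun j => Q (s j)) (Finset.mem_univ i)]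
  simp only [Function.update_self, measure_univ, one_mul]
  rw [mul_comm]
  congr 1
  exact Finset.prod_congr rfl fun j hj => by rw [Function.update_of_ne (Finset.ne_of_mem_erase hj)]

end General

/-! ## Units of a pair by treatment status -/

/-- The position in the `j`-th pair of the unit with treatment `s`, if `b j` is the treatment of
the first unit of that pair. -/
def slot {m : ℕ} (s : Bool) (b : Fin m → Bool) (j : Fin m) : Fin (2 * m) :=
  if b j = s then fstPos j else sndPos j

/-- The unit with treatment `s` in the `j`-th pair. -/
def pick {k m : ℕ} (π : (Fin (2 * m) → EuclideanSpace ℝ (Fin k)) → Equiv.Perm (Fin (2 * m)))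
    (s : Bool) (w : Fin (2 * m) → UnitData k) (b : Fin m → Bool) (j : Fin m) : Fin (2 * m) :=
  π (fun i => covX (w i)) (slot s b j)

lemma slot_inj {m : ℕ} {s s' : Bool} {b : Fin m → Bool} {j j' : Fin m}
    (h : slot s b j = slot s' b j') : s = s' ∧ j = j' := by
  have hj : j = j' := by
    unfold slot fstPos sndPos at h
    rw [Fin.ext_iff]
    split_ifs at h <;> simp at h <;> omega
  subst hj
  refine ⟨?_, rfl⟩
  unfold slot fstPos sndPos at h
  split_ifs at h with h1 h2 h2
  · exact h1.symm.trans h2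
  · simp at h
  · simp at h
  · revert h1 h2; cases b j <;> cases s <;> cases s' <;> simp

lemma sum_fstPos_add_sndPos {m : ℕ} (f : Fin (2 * m) → ℝ) :
    ∑ i, f i = ∑ j : Fin m, (f (fstPos j) + f (sndPos j)) := by
  -- With the constant assignment `true`, the label `true` selects the first position of a pair and
  -- `false` the second.
  have e : Function.Bijective (fun p : Fin m × Bool => slot p.2 (fun _ => true) p.1) := by
    rw [Fintype.bijective_iff_injective_and_card]
    refine ⟨fun p q h => ?_, by simp [mul_comm]⟩
    obtain ⟨h1, h2⟩ := slot_inj h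
    exact Prod.ext h2 h1
  rw [← Equiv.sum_comp (Equiv.ofBijective _ e) f, Fintype.sum_prod_type]
  refine Finset.sum_congr rfl fun j _ => ?_
  simp [slot]

lemma sum_slot {m : ℕ} (s : Bool) (b : Fin m → Bool) (f : Fin (2 * m) → ℝ) :
    ∑ i, f i = ∑ j : Fin m, (f (slot s b j) + f (slot (!s) b j)) := by
  rw [sum_fstPos_add_sndPos]
  refine Finset.sum_congr rfl fun j _ => ?_
  unfold slot
  cases b j <;> cases s <;> simp [add_comm]

section Pick

variable {k m : ℕ}
  {π : (Fin (2 * m) → EuclideanSpace ℝ (Fin k)) → Equiv.Perm (Fin (2 * m))}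

lemma sum_pick (s : Bool) (w : Fin (2 * m) → UnitData k) (b : Fin m → Bool)
    (f : Fin (2 * m) → ℝ) :
    ∑ i, f i = ∑ j : Fin m, (f (pick π s w b j) + f (pick π (!s) w b j)) := by
  rw [← Equiv.sum_comp (π fun i => covX (w i)) f, sum_slot s b]
  rfl

lemma sum_pick_le (s : Bool) (w : Fin (2 * m) → UnitData k) (b : Fin m → Bool)
    {f : Fin (2 * m) → ℝ} (hf : ∀ i, 0 ≤ f i) : ∑ j : Fin m, f (pick π s w b j) ≤ ∑ i, f i := by
  rw [sum_pick (π := π) s w b]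
  exact Finset.sum_le_sum fun j _ => le_add_of_nonneg_right (hf _)

lemma pick_inj {s s' : Bool} {w : Fin (2 * m) → UnitData k} {b : Fin m → Bool} {j j' : Fin m}
    (h : pick π s w b j = pick π s' w b j') : s = s' ∧ j = j' :=
  slot_inj ((π _).injective h)

/-- The pairing is a function of the covariates alone. This is what lets a unit be redrawn, with its
covariates kept, without disturbing who is matched with whom. -/
lemma pick_update {s : Bool} {w : Fin (2 * m) → UnitData k} {b : Fin m → Bool} {j : Fin m}
    {i : Fin (2 * m)} {a a' : UnitData k} (h : covX a = covX a') :
    pick π s (Function.update w i a) b j = pick π s (Function.update w i a') b j := by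
  have : (fun l => covX (Function.update w i a l)) = fun l => covX (Function.update w i a' l) := by
    ext1 l
    by_cases hl : l = i
    · subst hl; simpa using h
    · simp [Function.update_of_ne hl]
  simp only [pick, this]

lemma measurable_covX : Measurable (covX : UnitData k → _) :=
  measurable_snd.comp measurable_snd

/-- There are finitely many permutations, and on each level set of `π` the selected index depends on
the coins alone. -/
lemma measurable_pick (hπ : ∀ σ, MeasurableSet {x | π x = σ}) (s : Bool) (j : Fin m) :
    Measurable fun p : (Fin (2 * m) → UnitData k) × (Fin m → Bool) => pick π s p.1 p.2 j := by
  refine measurable_to_countable' fun i => ?_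
  have : (fun p : (Fin (2 * m) → UnitData k) × (Fin m → Bool) => pick π s p.1 p.2 j) ⁻¹' {i}
      = ⋃ σ : Equiv.Perm (Fin (2 * m)), ((fun p : (Fin (2 * m) → UnitData k) × (Fin m → Bool) =>
          fun l => covX (p.1 l)) ⁻¹' {x | π x = σ}) ∩
          (Prod.snd ⁻¹' {b | σ (slot s b j) = i}) := by
    ext p
    simp [pick]
  rw [this]
  refine MeasurableSet.iUnion fun σ => (MeasurableSet.inter ?_ ?_)
  · refine (measurable_pi_lambda _ fun l => ?_) (hπ σ)
    exact measurable_covX.comp ((measurable_pi_apply l).comp measurable_fst)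
  · exact measurable_snd (Set.toFinite _).measurableSet

lemma measurable_apply_pick (hπ : ∀ σ, MeasurableSet {x | π x = σ}) (s : Bool) (j : Fin m)
    {q : UnitData k → ℝ} (hq : Measurable q) :
    Measurable fun p : (Fin (2 * m) → UnitData k) × (Fin m → Bool) =>
      q (p.1 (pick π s p.1 p.2 j)) := by
  have h : Measurable fun r : Fin (2 * m) × (Fin (2 * m) → UnitData k) => q (r.2 r.1) :=
    measurable_from_prod_countable_right fun i => hq.comp (measurable_pi_apply i)
  exact h.comp ((measurable_pick hπ s j).prodMk measurable_fst)

variable {Q : Measure (UnitData k)} [IsProbabilityMeasure Q] {ν : Measure (Fin m → Bool)}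
  [IsProbabilityMeasure ν]

lemma measurePreserving_unit {n : ℕ} {β : Type*} [MeasurableSpace β] {ν : Measure β}
    [IsProbabilityMeasure ν] (i : Fin n) :
    MeasurePreserving (fun p : (Fin n → UnitData k) × β => p.1 i)
      ((Measure.pi fun _ => Q).prod ν) Q :=
  (measurePreserving_eval (fun _ : Fin n => Q) i).comp measurePreserving_fst

lemma ae_forall_unit {n : ℕ} {β : Type*} [MeasurableSpace β] {ν : Measure β}
    [IsProbabilityMeasure ν] {P : UnitData k → Prop} (h : ∀ᵐ w ∂Q, P w) :
    ∀ᵐ p ∂((Measure.pi fun _ : Fin n => Q).prod ν), ∀ i, P (p.1 i) :=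
  ae_all_iff.2 fun i => (measurePreserving_unit i).quasiMeasurePreserving.ae h

lemma integrable_unit {n : ℕ} {β : Type*} [MeasurableSpace β] {ν : Measure β}
    [IsProbabilityMeasure ν] {q : UnitData k → ℝ} (hq : Integrable q Q) (i : Fin n) :
    Integrable (fun p => q (p.1 i)) ((Measure.pi fun _ : Fin n => Q).prod ν) :=
  (measurePreserving_unit i).integrable_comp_of_integrable hq

lemma integral_unit {n : ℕ} {β : Type*} [MeasurableSpace β] {ν : Measure β}
    [IsProbabilityMeasure ν] {q : UnitData k → ℝ} (hq : Integrable q Q) (i : Fin n) :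
    ∫ p, q (p.1 i) ∂((Measure.pi fun _ : Fin n => Q).prod ν) = ∫ w, q w ∂Q := by
  have h := measurePreserving_unit (Q := Q) (ν := ν) i
  rw [← h.map_eq] at hq
  conv_rhs => rw [← h.map_eq]
  rw [integral_map h.measurable.aemeasurable hq.aestronglyMeasurable]

lemma integrable_apply_pick (hπ : ∀ σ, MeasurableSet {x | π x = σ}) (s : Bool) (j : Fin m)
    {q : UnitData k → ℝ} (hq : Integrable q Q) :
    Integrable (fun p : (Fin (2 * m) → UnitData k) × (Fin m → Bool) =>
      q (p.1 (pick π s p.1 p.2 j))) ((Measure.pi fun _ => Q).prod ν) := by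
  -- Splitting by the index selected reduces a random unit to fixed ones.
  have : (fun p : (Fin (2 * m) → UnitData k) × (Fin m → Bool) => q (p.1 (pick π s p.1 p.2 j)))
      = fun p => ∑ i, ((fun p : (Fin (2 * m) → UnitData k) × (Fin m → Bool) =>
          pick π s p.1 p.2 j) ⁻¹' {i}).indicator (fun p => q (p.1 i)) p := by
    funext p
    refine ((Finset.sum_eq_single (pick π s p.1 p.2 j) (fun i _ hi => ?_) (by simp)).trans
      ?_).symm
    · rw [Set.indicator_of_notMem]
      exact fun h => hi (Eq.symm h)
    · rw [Set.indicator_of_mem]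
      exact Set.mem_singleton _
  rw [this]
  exact integrable_finsetSum _ fun i _ => (integrable_unit hq i).indicator
    (measurable_pick hπ s j (measurableSet_singleton i))

/-- Comparison of first absolute moments of two statistics whose difference is bounded by a sum
over all units. -/
lemma integral_abs_le_add_of_le_sum
    {S S' : (Fin (2 * m) → UnitData k) × (Fin m → Bool) → ℝ} {g : UnitData k → ℝ}
    (hS : Integrable S ((Measure.pi fun _ => Q).prod ν))
    (hS' : Integrable S' ((Measure.pi fun _ => Q).prod ν)) (hg : Integrable g Q)
    (hg0 : ∀ w, 0 ≤ g w)
    (h : ∀ᵐ p ∂((Measure.pi fun _ => Q).prod ν), |S p| ≤ |S' p| + (m : ℝ)⁻¹ * ∑ i, g (p.1 i)) :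
    ∫ p, |S p| ∂((Measure.pi fun _ => Q).prod ν)
      ≤ ∫ p, |S' p| ∂((Measure.pi fun _ => Q).prod ν) + 2 * ∫ w, g w ∂Q := by
  have hi : Integrable (fun p : (Fin (2 * m) → UnitData k) × (Fin m → Bool) =>
      (m : ℝ)⁻¹ * ∑ i, g (p.1 i)) ((Measure.pi fun _ => Q).prod ν) :=
    (integrable_finsetSum _ fun i _ => integrable_unit hg i).const_mul _
  have h0 : 0 ≤ ∫ w, g w ∂Q := integral_nonneg hg0
  calc _ ≤ ∫ p, (|S' p| + (m : ℝ)⁻¹ * ∑ i, g (p.1 i)) ∂((Measure.pi fun _ => Q).prod ν) :=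
        integral_mono_ae hS.abs (hS'.abs.add hi) h
    _ = ∫ p, |S' p| ∂((Measure.pi fun _ => Q).prod ν) + (m : ℝ)⁻¹ * (2 * m * ∫ w, g w ∂Q) := by
      rw [integral_add hS'.abs hi, integral_const_mul,
        integral_finsetSum _ fun i _ => integrable_unit hg i]
      simp_rw [integral_unit hg]
      simp
    _ ≤ _ := by
      refine add_le_add_right ?_ _
      rcases Nat.eq_zero_or_pos m with hm | hm
      · simp only [hm, Nat.cast_zero, inv_zero, zero_mul]; positivity
      · have : (m : ℝ) ≠ 0 := by positivity
        apply le_of_eq; field_simp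

/-! ## Orthogonality -/

/-- A function of the covariates can be pulled out of `E[· | X]`, and the tower property concludes.
-/
lemma integral_mul_eq_zero_of_condX_eq_zero {u g : UnitData k → ℝ} (hu : Integrable u Q)
    (hu0 : condX Q u =ᵐ[Q] 0) (hg : Measurable g) (hinv : ∀ a a', covX a = covX a' → g a = g a')
    (hint : Integrable (fun a => u a * g a) Q) : ∫ a, u a * g a ∂Q = 0 := by
  have hm : MeasurableSpace.comap (covX : UnitData k → _) inferInstance
      ≤ (inferInstance : MeasurableSpace (UnitData k)) :=
    measurable_covX.comap_le
  have hg' : StronglyMeasurable[MeasurableSpace.comap (covX : UnitData k → _) inferInstance] g := by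
    -- Freezing outcomes and responses at arbitrary values exhibits `g` as a measurable function of
    -- the covariates.
    have h0 : Measurable fun x : EuclideanSpace ℝ (Fin k) =>
        g ((fun _ => 0), (fun _ => false), x) := by
      apply hg.comp
      fun_prop
    have : g = (fun x : EuclideanSpace ℝ (Fin k) => g ((fun _ => 0), (fun _ => false), x)) ∘ covX := by
      ext a
      exact hinv _ _ rfl
    rw [this]
    exact (h0.comp (comap_measurable _)).stronglyMeasurable
  rw [← integral_condExp hm]
  refine integral_eq_zero_of_ae ?_
  have := condExp_mul_of_stronglyMeasurable_right hg' hint hu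
  filter_upwards [this, hu0] with a h1 h2
  have h2' : (Q[u|MeasurableSpace.comap (covX : UnitData k → _) inferInstance]) a = 0 := h2
  refine h1.trans ?_
  simp [h2']

/-- A centered function of one unit is orthogonal to every function of the data that depends on
that unit only through its covariates. -/
lemma integral_unit_mul_eq_zero {n : ℕ} {β : Type*} [MeasurableSpace β] {ν : Measure β}
    [IsProbabilityMeasure ν] (i : Fin n) {u : UnitData k → ℝ} (hu : Integrable u Q)
    (hu0 : condX Q u =ᵐ[Q] 0) {H : (Fin n → UnitData k) × β → ℝ} (hH : Measurable H)
    (hinv : ∀ w b a a', covX a = covX a' →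
      H (Function.update w i a, b) = H (Function.update w i a', b))
    (hint : Integrable (fun p => u (p.1 i) * H p) ((Measure.pi fun _ => Q).prod ν)) :
    ∫ p, u (p.1 i) * H p ∂((Measure.pi fun _ => Q).prod ν) = 0 := by
  -- Redraw unit `i` independently. With the coins `b` and the other units fixed, `H` depends on the
  -- new draw only through its covariates, so the inner integral vanishes.
  have hmp := (measurePreserving_update Q i).prod (MeasurePreserving.id ν)
  have hint' := hmp.integrable_comp_of_integrable hint
  have heq : ∫ p, u (p.1 i) * H p ∂((Measure.pi fun _ => Q).prod ν)
      = ∫ r : ((Fin n → UnitData k) × UnitData k) × β,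
          u r.1.2 * H (Function.update r.1.1 i r.1.2, r.2)
            ∂(((Measure.pi fun _ => Q).prod Q).prod ν) := by
    conv_lhs => rw [← hmp.map_eq]
    rw [integral_map hmp.measurable.aemeasurable
      (by rw [hmp.map_eq]; exact hint.aestronglyMeasurable)]
    simp [Prod.map]
  have hint'' : Integrable (fun r : ((Fin n → UnitData k) × UnitData k) × β =>
      u r.1.2 * H (Function.update r.1.1 i r.1.2, r.2))
      (((Measure.pi fun _ => Q).prod Q).prod ν) := by
    refine hint'.congr (Eventually.of_forall fun r => ?_)
    simp [Prod.map]
  rw [heq, integral_prod_symm _ hint'']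
  refine integral_eq_zero_of_ae ?_
  filter_upwards [hint''.prod_left_ae] with b hb
  simp only [Pi.zero_apply]
  rw [integral_prod _ hb]
  refine integral_eq_zero_of_ae ?_
  filter_upwards [hb.prod_right_ae] with w hw
  refine integral_mul_eq_zero_of_condX_eq_zero (g := fun a => H (Function.update w i a, b))
    hu hu0 ?_ (hinv w b) hw
  exact hH.comp ((measurable_update w).prodMk measurable_const)

/-- The four units involved are distinct. Once the position of the centered one is fixed, the other
three factors see it only through its covariates, via the pairing. -/
lemma integral_pick_mul_pick_eq_zero (hπ : ∀ σ, MeasurableSet {x | π x = σ}) (s : Bool)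
    {u v : UnitData k → ℝ} {C : ℝ} (hum : Measurable u) (hvm : Measurable v)
    (hu : ∀ᵐ w ∂Q, |u w| ≤ C) (hv : ∀ᵐ w ∂Q, |v w| ≤ C) (hu0 : condX Q u =ᵐ[Q] 0)
    {j j' : Fin m} (hj : j ≠ j') :
    ∫ p, (u (p.1 (pick π s p.1 p.2 j)) * v (p.1 (pick π (!s) p.1 p.2 j)))
      * (u (p.1 (pick π s p.1 p.2 j')) * v (p.1 (pick π (!s) p.1 p.2 j')))
        ∂((Measure.pi fun _ => Q).prod ν) = 0 := by
  -- `H i` collects the other three factors on the event that the unit carrying the centered factor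
  -- is `i`; summing over `i` recovers the integrand.
  let H : Fin (2 * m) → (Fin (2 * m) → UnitData k) × (Fin m → Bool) → ℝ := fun i p =>
    if pick π s p.1 p.2 j = i then v (p.1 (pick π (!s) p.1 p.2 j))
      * (u (p.1 (pick π s p.1 p.2 j')) * v (p.1 (pick π (!s) p.1 p.2 j'))) else 0
  have hHm : ∀ i, Measurable (H i) := fun i =>
    Measurable.ite (measurable_pick hπ s j (measurableSet_singleton i))
      ((measurable_apply_pick hπ (!s) j hvm).mul ((measurable_apply_pick hπ s j' hum).mul
        (measurable_apply_pick hπ (!s) j' hvm))) measurable_const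
  have hC : 0 ≤ C := by
    obtain ⟨w, hw⟩ := hu.exists
    exact (abs_nonneg _).trans hw
  have hint : ∀ i, Integrable (fun p => u (p.1 i) * H i p) ((Measure.pi fun _ => Q).prod ν) := by
    intro i
    refine Integrable.of_bound (C := C * (C * (C * C))) ?_ ?_
    · exact ((hum.comp ((measurable_pi_apply i).comp measurable_fst)).mul
        (hHm i)).aestronglyMeasurable
    · filter_upwards [ae_forall_unit hu, ae_forall_unit hv] with p h1 h2
      simp only [H, Real.norm_eq_abs]
      split_ifs
      · simp only [abs_mul]
        gcongr <;> first | exact h1 _ | exact h2 _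
      · simp only [mul_zero, abs_zero]; positivity
  have hsum : ∀ p : (Fin (2 * m) → UnitData k) × (Fin m → Bool),
      (u (p.1 (pick π s p.1 p.2 j)) * v (p.1 (pick π (!s) p.1 p.2 j)))
      * (u (p.1 (pick π s p.1 p.2 j')) * v (p.1 (pick π (!s) p.1 p.2 j')))
      = ∑ i, u (p.1 i) * H i p := by
    intro p
    simp only [H, mul_ite, mul_zero, Finset.sum_ite_eq, Finset.mem_univ, if_true]
    ring
  simp_rw [hsum]
  rw [integral_finsetSum _ fun i _ => hint i]
  refine Finset.sum_eq_zero fun i _ => ?_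
  refine integral_unit_mul_eq_zero i (Integrable.of_bound hum.aestronglyMeasurable C hu) hu0
    (hHm i) (fun w b a a' haa => ?_) (hint i)
  simp only [H, pick_update (π := π) (w := w) (b := b) (i := i) haa]
  split_ifs with hi
  · have h1 : pick π (!s) (Function.update w i a') b j ≠ i := fun h =>
      absurd (pick_inj (hi.trans h.symm)).1 (by cases s <;> simp)
    have h2 : pick π s (Function.update w i a') b j' ≠ i := fun h =>
      hj (pick_inj (hi.trans h.symm)).2
    have h3 : pick π (!s) (Function.update w i a') b j' ≠ i := fun h =>
      hj (pick_inj (hi.trans h.symm)).2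
    simp only [Function.update_of_ne h1, Function.update_of_ne h2, Function.update_of_ne h3]
  · rfl

end Pick

/-! ## Laws of large numbers in mean -/

/-- The number `1` for `true` and `-1` for `false`. -/
noncomputable def sgn (b : Bool) : ℝ := if b then 1 else -1

section CondX

variable {k : ℕ} {Q : Measure (UnitData k)}

lemma measurable_condX (f : UnitData k → ℝ) : Measurable (condX Q f) :=
  (stronglyMeasurable_condExp.mono measurable_covX.comap_le).measurable

lemma integrable_condX (f : UnitData k → ℝ) : Integrable (condX Q f) Q := integrable_condExp

lemma condX_sub_condX [IsProbabilityMeasure Q] {f : UnitData k → ℝ} (hf : Integrable f Q) :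
    condX Q (fun w => f w - condX Q f w) =ᵐ[Q] 0 := by
  have h1 : condX Q (f - condX Q f) =ᵐ[Q] condX Q f - condX Q (condX Q f) :=
    condExp_sub hf (integrable_condX f) _
  have h2 : condX Q (condX Q f) = condX Q f :=
    condExp_of_stronglyMeasurable measurable_covX.comap_le stronglyMeasurable_condExp
      (integrable_condX f)
  rw [h2, sub_self] at h1
  exact h1

lemma integral_abs_condX_sub_le {f f' : UnitData k → ℝ} (hf : Integrable f Q)
    (hf' : Integrable f' Q) :
    ∫ w, |condX Q f w - condX Q f' w| ∂Q ≤ ∫ w, |f w - f' w| ∂Q := by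
  have h1 : condX Q (f - f') =ᵐ[Q] condX Q f - condX Q f' := condExp_sub hf hf' _
  calc _ = ∫ w, |condX Q (f - f') w| ∂Q := by
        refine integral_congr_ae ?_
        filter_upwards [h1] with w hw
        rw [hw]; rfl
    _ ≤ _ := integral_abs_condExp_le _

lemma ae_abs_condX_le {f : UnitData k → ℝ} {C : ℝ} (hf : ∀ w, |f w| ≤ C) :
    ∀ᵐ w ∂Q, |condX Q f w| ≤ C :=
  ae_bdd_abs_condExp_of_ae_bdd_abs (Eventually.of_forall hf)

end CondX

lemma tendsto_const_div_sqrt (C : ℝ) : Tendsto (fun m : ℕ => C / √(m : ℝ)) atTop (𝓝 0) :=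
  tendsto_const_nhds.div_atTop (Real.tendsto_sqrt_atTop.comp tendsto_natCast_atTop_atTop)

section Asymptotics

variable {k : ℕ} {Q : Measure (UnitData k)} [IsProbabilityMeasure Q]
  {ν : (m : ℕ) → Measure (Fin m → Bool)} [∀ m, IsProbabilityMeasure (ν m)]
  {π : (m : ℕ) → (Fin (2 * m) → EuclideanSpace ℝ (Fin k)) → Equiv.Perm (Fin (2 * m))}

lemma integrable_mean_unit (m : ℕ) {q : UnitData k → ℝ} (hq : Integrable q Q) :
    Integrable (fun p : (Fin (2 * m) → UnitData k) × (Fin m → Bool) =>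
      (m : ℝ)⁻¹ * ∑ i, (q (p.1 i) - ∫ w, q w ∂Q)) ((Measure.pi fun _ => Q).prod (ν m)) :=
  (integrable_finsetSum _ fun i _ => (integrable_unit hq i).sub (integrable_const _)).const_mul _

/-- The weak law of large numbers, in mean. -/
lemma tendsto_integral_abs_mean_unit {q : UnitData k → ℝ} (hq : Integrable q Q) :
    Tendsto (fun m : ℕ => ∫ p, |(m : ℝ)⁻¹ * ∑ i : Fin (2 * m), (q (p.1 i) - ∫ w, q w ∂Q)|
      ∂((Measure.pi fun _ => Q).prod (ν m))) atTop (𝓝 0) := by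
  -- The constant is 4: there are `2m` units against the normalization `1/m`, and changing `q` also
  -- changes its mean.
  refine tendsto_zero_of_tendsto_zero_bounded (Q := Q) (c := 4)
    (N := fun m q => ∫ p, |(m : ℝ)⁻¹ * ∑ i : Fin (2 * m), (q (p.1 i) - ∫ w, q w ∂Q)|
      ∂((Measure.pi fun _ => Q).prod (ν m)))
    (fun m q => integral_nonneg fun _ => abs_nonneg _) ?_ ?_ hq
  · intro q hqm C hC hqi
    have hC0 : 0 ≤ C := (abs_nonneg _).trans (hC ((fun _ => 0), (fun _ => false), 0))
    have hmean : |∫ w, q w ∂Q| ≤ C := by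
      have := norm_integral_le_of_norm_le_const (μ := Q) (f := q) (C := C) (Eventually.of_forall hC)
      simpa using this
    refine squeeze_zero (fun m => integral_nonneg fun _ => abs_nonneg _) (fun m => ?_)
      (tendsto_const_div_sqrt (2 * (2 * C)))
    have h1 := integral_abs_mean_le_of_orthogonal (ι := Fin (2 * m))
      (μ := (Measure.pi fun _ : Fin (2 * m) => Q).prod (ν m))
      (ψ := fun i p => q (p.1 i) - ∫ w, q w ∂Q) (C := 2 * C) (by positivity)
      (fun i => ((integrable_unit hqi i).sub (integrable_const _)).aestronglyMeasurable)
      (fun i => Eventually.of_forall fun p => by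
        have := abs_sub (q (p.1 i)) (∫ w, q w ∂Q)
        linarith [hC (p.1 i)]) ?_
    · have h2 : ∀ p : (Fin (2 * m) → UnitData k) × (Fin m → Bool),
          |(m : ℝ)⁻¹ * ∑ i, (q (p.1 i) - ∫ w, q w ∂Q)|
          = 2 * |(Fintype.card (Fin (2 * m)) : ℝ)⁻¹ * ∑ i, (q (p.1 i) - ∫ w, q w ∂Q)| := by
        intro p
        have h3 : (m : ℝ)⁻¹ = 2 * (Fintype.card (Fin (2 * m)) : ℝ)⁻¹ := by
          rw [Fintype.card_fin]
          push_cast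
          rw [mul_inv, mul_inv_cancel_left₀ two_ne_zero]
        rw [h3, mul_assoc, abs_mul, abs_two]
      simp_rw [h2]
      rw [integral_const_mul]
      refine (mul_le_mul_of_nonneg_left h1 zero_le_two).trans ?_
      rw [mul_div_assoc 2 (2 * C) √(m : ℝ)]
      refine mul_le_mul_of_nonneg_left ?_ zero_le_two
      rcases Nat.eq_zero_or_pos m with hm | hm
      · simp [hm]
      · have : 0 < √(m : ℝ) := Real.sqrt_pos.2 (by exact_mod_cast hm)
        gcongr
        simp only [Fintype.card_fin]
        linarith
    · intro i i' hii
      have hind : IndepFun (fun w : Fin (2 * m) → UnitData k => q (w i) - ∫ w, q w ∂Q)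
          (fun w => q (w i') - ∫ w, q w ∂Q) (Measure.pi fun _ => Q) :=
        (iIndepFun_pi (μ := fun _ : Fin (2 * m) => Q) (X := fun _ w => q w - ∫ w, q w ∂Q)
          fun _ => (hqm.sub_const _).aemeasurable).indepFun hii
      have h0 : ∫ w : Fin (2 * m) → UnitData k, (q (w i) - ∫ w, q w ∂Q)
          ∂(Measure.pi fun _ => Q) = 0 := by
        have := integral_comp_eval (μ := fun _ : Fin (2 * m) => Q) (i := i)
          (f := fun w => q w - ∫ w, q w ∂Q) (hqm.sub_const _).aestronglyMeasurable
        rw [this, integral_sub hqi (integrable_const _)]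
        simp
      have h3 := integral_fun_fst (μ := Measure.pi fun _ : Fin (2 * m) => Q) (ν := ν m)
        (fun w => (q (w i) - ∫ w, q w ∂Q) * (q (w i') - ∫ w, q w ∂Q))
      rw [h3, hind.integral_fun_mul_eq_mul_integral
        ((hqm.comp (measurable_pi_apply i)).sub_const _).aestronglyMeasurable
        ((hqm.comp (measurable_pi_apply i')).sub_const _).aestronglyMeasurable, h0]
      simp
  · intro m q q' hq hq'
    have hd : Integrable (fun w => |q w - q' w|) Q := (hq.sub hq').abs
    refine (integral_abs_le_add_of_le_sum (integrable_mean_unit m hq) (integrable_mean_unit m hq')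
      (hd.add (integrable_const (∫ w, |q w - q' w| ∂Q)))
      (fun w => add_nonneg (abs_nonneg _) (integral_nonneg fun _ => abs_nonneg _))
      (Eventually.of_forall fun p => ?_)).trans ?_
    · have h1 : |∑ i, (q (p.1 i) - ∫ w, q w ∂Q)| ≤ |∑ i, (q' (p.1 i) - ∫ w, q' w ∂Q)|
          + ∑ i, (|q (p.1 i) - q' (p.1 i)| + ∫ w, |q w - q' w| ∂Q) := by
        rw [← sub_le_iff_le_add']
        refine (abs_sub_abs_le_abs_sub _ _).trans ?_
        rw [← Finset.sum_sub_distrib]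
        refine (Finset.abs_sum_le_sum_abs _ _).trans (Finset.sum_le_sum fun i _ => ?_)
        have h2 : |∫ w, q w ∂Q - ∫ w, q' w ∂Q| ≤ ∫ w, |q w - q' w| ∂Q := by
          rw [← integral_sub hq hq']
          exact abs_integral_le_integral_abs
        rw [show q (p.1 i) - ∫ w, q w ∂Q - (q' (p.1 i) - ∫ w, q' w ∂Q)
          = (q (p.1 i) - q' (p.1 i)) - (∫ w, q w ∂Q - ∫ w, q' w ∂Q) by ring]
        exact (abs_sub _ _).trans (by gcongr)
      rw [abs_mul, abs_mul, abs_of_nonneg (by positivity : (0 : ℝ) ≤ (m : ℝ)⁻¹), ← mul_add]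
      exact mul_le_mul_of_nonneg_left h1 (by positivity)
    · simp only [Pi.add_apply]
      rw [integral_add hd (integrable_const _)]
      simp only [integral_const, probReal_univ, one_smul]
      linarith

lemma integrable_mean_pick_sub (hπ : ∀ m σ, MeasurableSet {x | π m x = σ}) (s : Bool) (m : ℕ)
    {q : UnitData k → ℝ} (hq : Integrable q Q) :
    Integrable (fun p : (Fin (2 * m) → UnitData k) × (Fin m → Bool) =>
      (m : ℝ)⁻¹ * ∑ j, (q (p.1 (pick (π m) s p.1 p.2 j)) - q (p.1 (pick (π m) (!s) p.1 p.2 j))))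
      ((Measure.pi fun _ => Q).prod (ν m)) :=
  (integrable_finsetSum _ fun j _ => (integrable_apply_pick (hπ m) s j hq).sub
    (integrable_apply_pick (hπ m) (!s) j hq)).const_mul _

/-- Swapping the two members of a pair only flips a sign, so the coin factors out of a quantity that
depends on the sample alone. -/
lemma sub_pick_eq_sgn_mul {m : ℕ} (s : Bool) (w : Fin (2 * m) → UnitData k) (b : Fin m → Bool)
    (j : Fin m) (q : UnitData k → ℝ) :
    q (w (pick (π m) s w b j)) - q (w (pick (π m) (!s) w b j))
      = sgn s * sgn (b j) * (q (w (π m (fun i => covX (w i)) (fstPos j)))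
        - q (w (π m (fun i => covX (w i)) (sndPos j)))) := by
  unfold pick slot sgn
  cases s <;> cases b j <;> simp

/-- The difference between the treated and the untreated units averages out. -/
lemma tendsto_integral_abs_mean_pick_sub (hπ : ∀ m σ, MeasurableSet {x | π m x = σ})
    (hν : ∀ m (j j' : Fin m), j ≠ j' → ∫ b, sgn (b j) * sgn (b j') ∂(ν m) = 0) (s : Bool)
    {q : UnitData k → ℝ} (hq : Integrable q Q) :
    Tendsto (fun m : ℕ => ∫ p, |(m : ℝ)⁻¹ * ∑ j : Fin m,
        (q (p.1 (pick (π m) s p.1 p.2 j)) - q (p.1 (pick (π m) (!s) p.1 p.2 j)))|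
      ∂((Measure.pi fun _ => Q).prod (ν m))) atTop (𝓝 0) := by
  refine tendsto_zero_of_tendsto_zero_bounded (Q := Q) (c := 2)
    (N := fun m q => ∫ p, |(m : ℝ)⁻¹ * ∑ j : Fin m,
        (q (p.1 (pick (π m) s p.1 p.2 j)) - q (p.1 (pick (π m) (!s) p.1 p.2 j)))|
      ∂((Measure.pi fun _ => Q).prod (ν m)))
    (fun m q => integral_nonneg fun _ => abs_nonneg _) ?_ ?_ hq
  · intro q hqm C hC hqi
    have hC0 : 0 ≤ C := (abs_nonneg _).trans (hC ((fun _ => 0), (fun _ => false), 0))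
    refine squeeze_zero (fun m => integral_nonneg fun _ => abs_nonneg _) (fun m => ?_)
      (tendsto_const_div_sqrt (2 * C))
    have h1 := integral_abs_mean_le_of_orthogonal (ι := Fin m)
      (μ := (Measure.pi fun _ : Fin (2 * m) => Q).prod (ν m))
      (ψ := fun j p => q (p.1 (pick (π m) s p.1 p.2 j)) - q (p.1 (pick (π m) (!s) p.1 p.2 j)))
      (C := 2 * C) (by positivity)
      (fun j => ((integrable_apply_pick (hπ m) s j hqi).sub
        (integrable_apply_pick (hπ m) (!s) j hqi)).aestronglyMeasurable)
      (fun j => Eventually.of_forall fun p => by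
        have := abs_sub (q (p.1 (pick (π m) s p.1 p.2 j))) (q (p.1 (pick (π m) (!s) p.1 p.2 j)))
        linarith [hC (p.1 (pick (π m) s p.1 p.2 j)), hC (p.1 (pick (π m) (!s) p.1 p.2 j))]) ?_
    · simpa using h1
    · intro j j' hjj
      have : ∀ p : (Fin (2 * m) → UnitData k) × (Fin m → Bool),
          (q (p.1 (pick (π m) s p.1 p.2 j)) - q (p.1 (pick (π m) (!s) p.1 p.2 j)))
          * (q (p.1 (pick (π m) s p.1 p.2 j')) - q (p.1 (pick (π m) (!s) p.1 p.2 j')))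
          = ((q (p.1 (π m (fun i => covX (p.1 i)) (fstPos j)))
            - q (p.1 (π m (fun i => covX (p.1 i)) (sndPos j))))
            * (q (p.1 (π m (fun i => covX (p.1 i)) (fstPos j')))
            - q (p.1 (π m (fun i => covX (p.1 i)) (sndPos j')))))
            * (sgn (p.2 j) * sgn (p.2 j')) := by
        intro p
        have hs : sgn s * sgn s = 1 := by cases s <;> simp [sgn]
        rw [sub_pick_eq_sgn_mul, sub_pick_eq_sgn_mul]
        linear_combination (sgn (p.2 j) * sgn (p.2 j') * ((q (p.1 (π m (fun i => covX (p.1 i)) (fstPos j)))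
            - q (p.1 (π m (fun i => covX (p.1 i)) (sndPos j))))
            * (q (p.1 (π m (fun i => covX (p.1 i)) (fstPos j')))
            - q (p.1 (π m (fun i => covX (p.1 i)) (sndPos j')))))) * hs
      simp_rw [this]
      -- Under the product measure the data and the coin signs separate, and the sign factor has
      -- mean zero.
      have h3 := integral_prod_mul (μ := Measure.pi fun _ : Fin (2 * m) => Q) (ν := ν m)
        (fun w => (q (w (π m (fun i => covX (w i)) (fstPos j)))
            - q (w (π m (fun i => covX (w i)) (sndPos j))))
            * (q (w (π m (fun i => covX (w i)) (fstPos j')))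
            - q (w (π m (fun i => covX (w i)) (sndPos j')))))
        (fun b => sgn (b j) * sgn (b j'))
      rw [h3, hν m j j' hjj, mul_zero]
  · intro m q q' hq hq'
    refine integral_abs_le_add_of_le_sum (integrable_mean_pick_sub hπ s m hq)
      (integrable_mean_pick_sub hπ s m hq') (hq.sub hq').abs
      (fun w => abs_nonneg _) (Eventually.of_forall fun p => ?_)
    rw [abs_mul, abs_mul, abs_of_nonneg (by positivity : (0 : ℝ) ≤ (m : ℝ)⁻¹), ← mul_add]
    refine mul_le_mul_of_nonneg_left ?_ (by positivity)
    rw [← sub_le_iff_le_add']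
    refine (abs_sub_abs_le_abs_sub _ _).trans ?_
    rw [← Finset.sum_sub_distrib, sum_pick (π := π m) s p.1 p.2]
    refine (Finset.abs_sum_le_sum_abs _ _).trans (Finset.sum_le_sum fun j _ => ?_)
    rw [sub_sub_sub_comm]
    exact abs_sub _ _

lemma integrable_pick_mul_pick (hπ : ∀ m σ, MeasurableSet {x | π m x = σ}) (s : Bool) {m : ℕ}
    (j : Fin m) {f h : UnitData k → ℝ} (hf : Integrable f Q) (hh : Measurable h) {C : ℝ}
    (hC : ∀ᵐ w ∂Q, |h w| ≤ C) :
    Integrable (fun p : (Fin (2 * m) → UnitData k) × (Fin m → Bool) =>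
      f (p.1 (pick (π m) s p.1 p.2 j)) * h (p.1 (pick (π m) (!s) p.1 p.2 j)))
      ((Measure.pi fun _ => Q).prod (ν m)) := by
  refine (integrable_apply_pick (hπ m) s j hf).mul_bdd (c := C)
    (measurable_apply_pick (hπ m) (!s) j hh).aestronglyMeasurable ?_
  filter_upwards [ae_forall_unit hC] with p hp
  exact hp _

lemma integrable_mean_pick_mul_pick (hπ : ∀ m σ, MeasurableSet {x | π m x = σ}) (s : Bool) (m : ℕ)
    {f h : UnitData k → ℝ} (hf : Integrable f Q) (hh : Measurable h) (hh1 : ∀ w, |h w| ≤ 1) :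
    Integrable (fun p : (Fin (2 * m) → UnitData k) × (Fin m → Bool) => (m : ℝ)⁻¹ * ∑ j,
        (f (p.1 (pick (π m) s p.1 p.2 j)) * h (p.1 (pick (π m) (!s) p.1 p.2 j))
          - condX Q f (p.1 (pick (π m) s p.1 p.2 j))
            * condX Q h (p.1 (pick (π m) (!s) p.1 p.2 j))))
      ((Measure.pi fun _ => Q).prod (ν m)) :=
  (integrable_finsetSum _ fun j _ =>
    (integrable_pick_mul_pick hπ s j hf hh (Eventually.of_forall hh1)).sub
      (integrable_pick_mul_pick hπ s j (integrable_condX f) (measurable_condX h)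
        (ae_abs_condX_le hh1))).const_mul _

/-- Centering one factor already makes the products orthogonal across pairs; the partner's factor
may be any bounded function. -/
lemma integral_abs_mean_centered_le (hπ : ∀ m σ, MeasurableSet {x | π m x = σ}) (s : Bool) (m : ℕ)
    {u v : UnitData k → ℝ} {C : ℝ} (hC : 0 ≤ C) (hum : Measurable u) (hvm : Measurable v)
    (hu : ∀ᵐ w ∂Q, |u w| ≤ C) (hv : ∀ᵐ w ∂Q, |v w| ≤ C) (hu0 : condX Q u =ᵐ[Q] 0) :
    ∫ p, |(m : ℝ)⁻¹ * ∑ j : Fin m,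
        u (p.1 (pick (π m) s p.1 p.2 j)) * v (p.1 (pick (π m) (!s) p.1 p.2 j))|
      ∂((Measure.pi fun _ => Q).prod (ν m)) ≤ (C * C) / √(m : ℝ) := by
  have h1 := integral_abs_mean_le_of_orthogonal (ι := Fin m)
    (μ := (Measure.pi fun _ : Fin (2 * m) => Q).prod (ν m))
    (ψ := fun j p => u (p.1 (pick (π m) s p.1 p.2 j)) * v (p.1 (pick (π m) (!s) p.1 p.2 j)))
    (C := C * C) (by positivity)
    (fun j => ((measurable_apply_pick (hπ m) s j hum).mul
      (measurable_apply_pick (hπ m) (!s) j hvm)).aestronglyMeasurable)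
    (fun j => by
      filter_upwards [ae_forall_unit hu, ae_forall_unit hv] with p h1 h2
      rw [abs_mul]
      exact mul_le_mul (h1 _) (h2 _) (abs_nonneg _) hC)
    (fun j j' hj => integral_pick_mul_pick_eq_zero (hπ m) s hum hvm hu hv hu0 hj)
  simpa using h1

/-- Products within the pairs may be replaced by products of conditional means. -/
lemma tendsto_integral_abs_mean_pick_mul_pick (hπ : ∀ m σ, MeasurableSet {x | π m x = σ})
    (s : Bool) {f h : UnitData k → ℝ} (hf : Integrable f Q) (hh : Measurable h)
    (hh1 : ∀ w, |h w| ≤ 1) :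
    Tendsto (fun m : ℕ => ∫ p, |(m : ℝ)⁻¹ * ∑ j : Fin m,
        (f (p.1 (pick (π m) s p.1 p.2 j)) * h (p.1 (pick (π m) (!s) p.1 p.2 j))
          - condX Q f (p.1 (pick (π m) s p.1 p.2 j))
            * condX Q h (p.1 (pick (π m) (!s) p.1 p.2 j)))|
      ∂((Measure.pi fun _ => Q).prod (ν m))) atTop (𝓝 0) := by
  have hhi : Integrable h Q := Integrable.of_bound hh.aestronglyMeasurable 1 (Eventually.of_forall hh1)
  have hh2 := ae_abs_condX_le (Q := Q) hh1
  -- The constant is 4: `2m` units against `1/m`, and both `f` and its conditional mean move, the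
  -- latter by no more in `L¹` than `f`.
  refine tendsto_zero_of_tendsto_zero_bounded (Q := Q) (c := 4)
    (N := fun m f => ∫ p, |(m : ℝ)⁻¹ * ∑ j : Fin m,
        (f (p.1 (pick (π m) s p.1 p.2 j)) * h (p.1 (pick (π m) (!s) p.1 p.2 j))
          - condX Q f (p.1 (pick (π m) s p.1 p.2 j))
            * condX Q h (p.1 (pick (π m) (!s) p.1 p.2 j)))|
      ∂((Measure.pi fun _ => Q).prod (ν m)))
    (fun m q => integral_nonneg fun _ => abs_nonneg _) ?_ ?_ hf
  · intro f hfm C hC hfi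
    have hC0 : 0 ≤ C := (abs_nonneg _).trans (hC ((fun _ => 0), (fun _ => false), 0))
    have hf2 := ae_abs_condX_le (Q := Q) hC
    have hlim := (tendsto_const_div_sqrt ((2 * C + 2) * (2 * C + 2))).add
      (tendsto_const_div_sqrt ((2 * C + 2) * (2 * C + 2)))
    rw [add_zero] at hlim
    refine squeeze_zero (fun m => integral_nonneg fun _ => abs_nonneg _) (fun m => ?_) hlim
    -- `2 * C + 2` is a common bound for all four factors, centered or not, since `|f| ≤ C` and `|h|
    -- ≤ 1`.
    have hu1 : ∀ᵐ w ∂Q, |f w - condX Q f w| ≤ 2 * C + 2 := by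
      filter_upwards [hf2] with w hw
      linarith [abs_sub (f w) (condX Q f w), hC w]
    have hu2 : ∀ᵐ w ∂Q, |h w - condX Q h w| ≤ 2 * C + 2 := by
      filter_upwards [hh2] with w hw
      linarith [abs_sub (h w) (condX Q h w), hh1 w]
    have hv1 : ∀ᵐ w ∂Q, |h w| ≤ 2 * C + 2 := Eventually.of_forall fun w => by linarith [hh1 w]
    have hv2 : ∀ᵐ w ∂Q, |condX Q f w| ≤ 2 * C + 2 := by
      filter_upwards [hf2] with w hw
      linarith
    have b1 := integral_abs_mean_centered_le (ν := ν)
      (u := fun w => f w - condX Q f w) hπ s m (by positivity)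
      (hfm.sub (measurable_condX f)) hh hu1 hv1 (condX_sub_condX hfi)
    -- In the second remainder the centered unit is the partner, so the arms are exchanged.
    have b2 := integral_abs_mean_centered_le (ν := ν)
      (u := fun w => h w - condX Q h w) hπ (!s) m (by positivity)
      (hh.sub (measurable_condX h)) (measurable_condX f) hu2 hv2 (condX_sub_condX hhi)
    have i1 : Integrable (fun p : (Fin (2 * m) → UnitData k) × (Fin m → Bool) => (m : ℝ)⁻¹ * ∑ j,
        (f (p.1 (pick (π m) s p.1 p.2 j)) - condX Q f (p.1 (pick (π m) s p.1 p.2 j)))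
          * h (p.1 (pick (π m) (!s) p.1 p.2 j))) ((Measure.pi fun _ => Q).prod (ν m)) :=
      (integrable_finsetSum _ fun j _ => integrable_pick_mul_pick
        (f := fun w => f w - condX Q f w) hπ s j (hfi.sub (integrable_condX f)) hh hv1).const_mul _
    have i2 : Integrable (fun p : (Fin (2 * m) → UnitData k) × (Fin m → Bool) => (m : ℝ)⁻¹ * ∑ j,
        (h (p.1 (pick (π m) (!s) p.1 p.2 j)) - condX Q h (p.1 (pick (π m) (!s) p.1 p.2 j)))
          * condX Q f (p.1 (pick (π m) (!!s) p.1 p.2 j)))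
        ((Measure.pi fun _ => Q).prod (ν m)) :=
      (integrable_finsetSum _ fun j _ => integrable_pick_mul_pick
        (f := fun w => h w - condX Q h w) hπ (!s) j (hhi.sub (integrable_condX h))
        (measurable_condX f) hv2).const_mul _
    refine le_trans ?_ (add_le_add b1 b2)
    rw [← integral_add i1.abs i2.abs]
    refine integral_mono (integrable_mean_pick_mul_pick hπ s m hfi hh hh1).abs (i1.abs.add i2.abs)
      fun p => ?_
    refine le_trans (le_of_eq ?_) (abs_add_le _ _)
    rw [← mul_add, ← Finset.sum_add_distrib]
    congr 2
    refine Finset.sum_congr rfl fun j _ => ?_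
    rw [Bool.not_not]
    ring
  · intro m f f' hf hf'
    have hcl := integral_abs_condX_sub_le hf hf'
    have j1 : Integrable (fun w => |f w - f' w|) Q := (hf.sub hf').abs
    have j2 : Integrable (fun w => |condX Q f w - condX Q f' w|) Q :=
      ((integrable_condX f).sub (integrable_condX f')).abs
    refine (integral_abs_le_add_of_le_sum (integrable_mean_pick_mul_pick hπ s m hf hh hh1)
      (integrable_mean_pick_mul_pick hπ s m hf' hh hh1) (j1.add j2)
      (fun w => add_nonneg (abs_nonneg _) (abs_nonneg _)) ?_).trans ?_
    · filter_upwards [ae_forall_unit hh2] with p hp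
      rw [abs_mul, abs_mul, abs_of_nonneg (by positivity : (0 : ℝ) ≤ (m : ℝ)⁻¹), ← mul_add]
      refine mul_le_mul_of_nonneg_left ?_ (by positivity)
      rw [← sub_le_iff_le_add']
      refine (abs_sub_abs_le_abs_sub _ _).trans ?_
      rw [← Finset.sum_sub_distrib]
      refine ((Finset.abs_sum_le_sum_abs _ _).trans (Finset.sum_le_sum fun j _ => ?_)).trans
        (sum_pick_le (π := π m) s p.1 p.2
          (f := fun i => |f (p.1 i) - f' (p.1 i)| + |condX Q f (p.1 i) - condX Q f' (p.1 i)|)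
          fun i => add_nonneg (abs_nonneg _) (abs_nonneg _))
      have e : ∀ a b c d a' c' : ℝ, a * b - c * d - (a' * b - c' * d)
        = (a - a') * b - (c - c') * d := fun _ _ _ _ _ _ => by ring
      rw [e]
      refine (abs_sub _ _).trans ?_
      rw [abs_mul, abs_mul]
      exact add_le_add (mul_le_of_le_one_right (abs_nonneg _) (hh1 _))
        (mul_le_of_le_one_right (abs_nonneg _) (hp _))
    · simp only [Pi.add_apply]
      rw [integral_add j1 j2]
      linarith

end Asymptotics

/-! ## The joint law of the sample and the assignment -/

instance : IsProbabilityMeasure fairPair :=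
  isProbabilityMeasure_uniformOn (Set.toFinite _) (by simp)

lemma ae_fairPair : ∀ᵐ z ∂fairPair, z.2 = !z.1 := by
  have h : ∀ᵐ z ∂fairPair, z ∈ ({(false, true), (true, false)} : Set (Bool × Bool)) :=
    ae_cond_mem (Set.toFinite _).measurableSet
  filter_upwards [h] with z hz
  rcases hz with rfl | rfl <;> rfl

lemma integral_sgn_fairPair : ∫ z, sgn z.1 ∂fairPair = 0 := by
  have h : ∀ z : Bool × Bool, fairPair.real {z}
      = (Measure.count.real ({(false, true), (true, false)} : Set (Bool × Bool)))⁻¹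
        * Measure.count.real ({(false, true), (true, false)} ∩ {z}) := fun z => by
    rw [fairPair, uniformOn, measureReal_def, cond_apply (Set.toFinite _).measurableSet,
      ENNReal.toReal_mul, ENNReal.toReal_inv]
    rfl
  have h2 : ({(false, true), (true, false)} : Set (Bool × Bool)) ∩ {(true, true)} = ∅ := by
    ext z; simp
  have h3 : ({(false, true), (true, false)} : Set (Bool × Bool)) ∩ {(false, false)} = ∅ := by
    ext z; simp
  have h4 : ({(false, true), (true, false)} : Set (Bool × Bool)) ∩ {(false, true)}
    = {(false, true)} := by ext z; simp
  have h5 : ({(false, true), (true, false)} : Set (Bool × Bool)) ∩ {(true, false)}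
    = {(true, false)} := by ext z; simp
  rw [integral_fintype (Integrable.of_finite)]
  simp [Fintype.sum_prod_type, h, h2, h3, h4, h5, sgn, measureReal_def]

section Assignment

variable {Ω : Type*} {mΩ : MeasurableSpace Ω} {μ : Measure Ω} {k m : ℕ}
  {π : (Fin (2 * m) → EuclideanSpace ℝ (Fin k)) → Equiv.Perm (Fin (2 * m))}
  {W : Fin (2 * m) → Ω → UnitData k} {D : Fin (2 * m) → Ω → Bool}

/-- The treatments of the pairs. -/
def pairTreatment (π : (Fin (2 * m) → EuclideanSpace ℝ (Fin k)) → Equiv.Perm (Fin (2 * m)))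
    (W : Fin (2 * m) → Ω → UnitData k) (D : Fin (2 * m) → Ω → Bool) (ω : Ω) (j : Fin m) :
    Bool × Bool :=
  (D (π (covVec W ω) (fstPos j)) ω, D (π (covVec W ω) (sndPos j)) ω)

lemma measurable_covVec (hW : ∀ i, Measurable (W i)) : Measurable (covVec W) :=
  measurable_pi_lambda _ fun i => measurable_covX.comp (hW i)

lemma measurable_pairTreatment (hπ : ∀ σ, MeasurableSet {x | π x = σ})
    (hW : ∀ i, Measurable (W i)) (hD : ∀ i, Measurable (D i)) :
    Measurable (pairTreatment π W D) := by
  refine measurable_to_countable' fun z => ?_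
  have : pairTreatment π W D ⁻¹' {z} = ⋃ σ : Equiv.Perm (Fin (2 * m)),
      (covVec W ⁻¹' {x | π x = σ}) ∩ ((fun ω i => D i ω) ⁻¹'
        {d | ∀ j, (d (σ (fstPos j)), d (σ (sndPos j))) = z j}) := by
    ext ω
    simp [pairTreatment, funext_iff]
  rw [this]
  exact MeasurableSet.iUnion fun σ => ((measurable_covVec hW) (hπ σ)).inter
    ((measurable_pi_lambda _ fun i => hD i) (Set.toFinite _).measurableSet)

lemma setIntegral_mul_condExp {m' : MeasurableSpace Ω} [IsFiniteMeasure μ] (hm : m' ≤ mΩ)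
    {g f : Ω → ℝ} (hg : StronglyMeasurable[m'] g) {C : ℝ} (hC : ∀ᵐ ω ∂μ, |g ω| ≤ C)
    (hf : Integrable f μ) {G : Set Ω} (hG : MeasurableSet[m'] G) :
    ∫ ω in G, g ω * (μ[f | m']) ω ∂μ = ∫ ω in G, g ω * f ω ∂μ := by
  have hgf : Integrable (fun ω => g ω * f ω) μ :=
    hf.bdd_mul (hg.mono hm).aestronglyMeasurable hC
  rw [← setIntegral_condExp hm hgf hG]
  refine setIntegral_congr_ae (hm _ hG) ?_
  filter_upwards [condExp_mul_of_stronglyMeasurable_left hg hgf hf] with ω hω _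
  exact hω.symm

/-- Given the covariates, the treatments of the pairs have the product law, and are independent of
the potential outcomes and responses. -/
lemma measure_inter_pairTreatment [IsProbabilityMeasure μ]
    (hπ : ∀ σ, MeasurableSet {x | π x = σ})
    (hW : ∀ i, Measurable (W i)) (hD : ∀ i, Measurable (D i))
    (h : IsMatchedPairAssignment π W D μ) {A : Set (Fin (2 * m) → (Bool → ℝ) × (Bool → Bool))}
    (hA : MeasurableSet A) {C : Set (Fin (2 * m) → EuclideanSpace ℝ (Fin k))}
    (hC : MeasurableSet C) (T : Fin m → Set (Bool × Bool)) :
    μ.real (((fun ω i => ((W i ω).1, (W i ω).2.1)) ⁻¹' A ∩ covVec W ⁻¹' C)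
        ∩ pairTreatment π W D ⁻¹' (Set.univ.pi T))
      = μ.real ((fun ω i => ((W i ω).1, (W i ω).2.1)) ⁻¹' A ∩ covVec W ⁻¹' C)
        * ∏ j, fairPair.real (T j) := by
  have hm : sigmaX W ≤ mΩ := (measurable_covVec hW).comap_le
  set E : Set Ω := (fun ω i => ((W i ω).1, (W i ω).2.1)) ⁻¹' A with hEdef
  have hE : MeasurableSet E :=
    (measurable_pi_lambda _ fun i => (hW i).fst.prodMk (hW i).snd.fst) hA
  have hDv : Measurable fun ω i => D i ω := measurable_pi_lambda _ fun i => hD i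
  set F : Set Ω := pairTreatment π W D ⁻¹' (Set.univ.pi T) with hFdef
  have hF : MeasurableSet F := measurable_pairTreatment hπ hW hD (Set.toFinite _).measurableSet
  set G : Set Ω := covVec W ⁻¹' C
  have hG : MeasurableSet[sigmaX W] G := ⟨C, hC, rfl⟩
  set g : Ω → ℝ := μ[E.indicator (fun _ => (1 : ℝ)) | sigmaX W] with hgdef
  have hg : StronglyMeasurable[sigmaX W] g := stronglyMeasurable_condExp
  have hind : ∀ s : Set Ω, MeasurableSet s → Integrable (s.indicator fun _ => (1 : ℝ)) μ :=
    fun s hs => (integrable_const _).indicator hs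
  have hgb : ∀ᵐ ω ∂μ, |g ω| ≤ 1 := by
    refine ae_bdd_abs_condExp_of_ae_bdd_abs (Eventually.of_forall fun ω => ?_)
    by_cases hω : ω ∈ E <;> simp [hω]
  have hgi : Integrable g μ := integrable_condExp
  have hset : ∀ s t : Set Ω, MeasurableSet s → MeasurableSet t →
      ∫ ω in t, s.indicator (fun _ => (1 : ℝ)) ω ∂μ = μ.real (s ∩ t) := fun s t hs ht => by
    rw [integral_indicator hs, Measure.restrict_restrict hs]; simp
  -- On each piece the pairing is a fixed permutation `σ`, so an event about pair treatments becomes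
  -- one about the vector `D`, to which conditional independence applies.
  let Gσ : Equiv.Perm (Fin (2 * m)) → Set Ω := fun σ => covVec W ⁻¹' (C ∩ {x | π x = σ})
  have hGσ : ∀ σ, MeasurableSet[sigmaX W] (Gσ σ) := fun σ => ⟨_, hC.inter (hπ σ), rfl⟩
  have hGU : G = ⋃ σ, Gσ σ := by
    ext ω; simp [G, Gσ]
  have hdisj : Pairwise (Function.onFun Disjoint Gσ) := by
    intro σ τ hστ
    refine Set.disjoint_left.2 fun ω h1 h2 => hστ ?_
    exact h1.2.symm.trans h2.2
  have hsplit : ∀ f : Ω → ℝ, Integrable f μ →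
      ∫ ω in G, f ω ∂μ = ∑ σ, ∫ ω in Gσ σ, f ω ∂μ := fun f hf => by
    rw [hGU, integral_iUnion_fintype (fun σ => hm _ (hGσ σ)) hdisj fun σ => hf.integrableOn]
  have hEF : ∫ ω in G, (E ∩ F).indicator (fun _ => (1 : ℝ)) ω ∂μ
      = ∫ ω in G, g ω * F.indicator (fun _ => (1 : ℝ)) ω ∂μ := by
    rw [hsplit _ (hind _ (hE.inter hF)), hsplit _ ((hind F hF).bdd_mul hgi.aestronglyMeasurable hgb)]
    refine Finset.sum_congr rfl fun σ _ => ?_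
    let B : Set (Fin (2 * m) → Bool) := {d | ∀ j, (d (σ (fstPos j)), d (σ (sndPos j))) ∈ T j}
    have hB : MeasurableSet B := (Set.toFinite _).measurableSet
    have hFB : ∀ ω ∈ Gσ σ, (ω ∈ F ↔ ω ∈ (fun ω i => D i ω) ⁻¹' B) := by
      intro ω hω
      have hσ : π (covVec W ω) = σ := hω.2
      simp [F, B, pairTreatment, hσ]
    have e1 : ∫ ω in Gσ σ, (E ∩ F).indicator (fun _ => (1 : ℝ)) ω ∂μ
        = ∫ ω in Gσ σ, (E ∩ (fun ω i => D i ω) ⁻¹' B).indicator (fun _ => (1 : ℝ)) ω ∂μ := by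
      rw [hset _ _ (hE.inter hF) (hm _ (hGσ σ)), hset _ _ (hE.inter (hDv hB)) (hm _ (hGσ σ))]
      congr 1
      ext ω
      simp only [Set.mem_inter_iff, and_congr_left_iff, and_congr_right_iff]
      exact fun hω _ => hFB ω hω
    have e2 : ∫ ω in Gσ σ, g ω * F.indicator (fun _ => (1 : ℝ)) ω ∂μ
        = ∫ ω in Gσ σ, g ω * ((fun ω i => D i ω) ⁻¹' B).indicator (fun _ => (1 : ℝ)) ω ∂μ := by
      refine setIntegral_congr_fun (hm _ (hGσ σ)) fun ω hω => ?_
      refine congrArg (g ω * ·) ?_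
      by_cases hω' : ω ∈ F
      · rw [Set.indicator_of_mem hω', Set.indicator_of_mem ((hFB ω hω).1 hω')]
      · rw [Set.indicator_of_notMem hω', Set.indicator_of_notMem (mt (hFB ω hω).2 hω')]
    rw [e1, e2, ← setIntegral_mul_condExp hm hg hgb (hind _ (hDv hB)) (hGσ σ),
      ← setIntegral_condExp hm (hind _ (hE.inter (hDv hB))) (hGσ σ)]
    refine setIntegral_congr_ae (hm _ (hGσ σ)) ?_
    filter_upwards [h.condIndep A B hA hB] with ω hω _
    exact hω
  have hFc : μ[F.indicator (fun _ => (1 : ℝ)) | sigmaX W] =ᵐ[μ]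
      fun _ => ∏ j, fairPair.real (T j) := by
    have h1 := h.condIID T fun j => (Set.toFinite _).measurableSet
    have h2 : F = ⋂ j, (fun ω => (D (π (covVec W ω) (fstPos j)) ω,
        D (π (covVec W ω) (sndPos j)) ω)) ⁻¹' T j := by
      ext ω; simp [F, pairTreatment]
    rw [h2]
    exact h1
  -- The conditional probability of `F` given the covariates is a constant, which leaves the
  -- integral.
  have h3 : ∫ ω in G, g ω * F.indicator (fun _ => (1 : ℝ)) ω ∂μ
      = μ.real (E ∩ G) * ∏ j, fairPair.real (T j) := by
    rw [← setIntegral_mul_condExp hm hg hgb (hind F hF) hG, ← hset E G hE (hm _ hG),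
      ← setIntegral_condExp hm (hind E hE) hG, ← integral_mul_const]
    refine setIntegral_congr_ae (hm _ hG) ?_
    filter_upwards [hFc] with ω hω _
    rw [hω]
  rw [← h3, ← hEF, hset _ _ (hE.inter hF) (hm _ hG), Set.inter_right_comm]

lemma isPiSystem_range_univ_pi {ι α : Type*} : IsPiSystem (Set.range fun T : ι → Set α => Set.univ.pi T) := by
  rintro _ ⟨T, rfl⟩ _ ⟨T', rfl⟩ -
  exact ⟨fun i => T i ∩ T' i, by simp [Set.pi_inter_distrib]⟩

lemma map_pairTreatment [IsProbabilityMeasure μ] (hπ : ∀ σ, MeasurableSet {x | π x = σ})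
    (hW : ∀ i, Measurable (W i)) (hD : ∀ i, Measurable (D i))
    (h : IsMatchedPairAssignment π W D μ) :
    μ.map (pairTreatment π W D) = Measure.pi fun _ => fairPair := by
  symm
  refine Measure.pi_eq fun T hT => ?_
  rw [Measure.map_apply (measurable_pairTreatment hπ hW hD) (MeasurableSet.univ_pi hT)]
  have h1 := measure_inter_pairTreatment hπ hW hD h MeasurableSet.univ MeasurableSet.univ T
  simp only [Set.preimage_univ, Set.univ_inter, probReal_univ, one_mul] at h1
  rw [← ENNReal.toReal_eq_toReal_iff' (measure_ne_top _ _)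
    (ENNReal.prod_ne_top fun _ _ => measure_ne_top _ _), ENNReal.toReal_prod]
  exact h1

/-- The factorization holds on rectangles and boxes. These form π-systems that generate the two
σ-algebras, so independence extends to all events. -/
lemma indepFun_pairTreatment [IsProbabilityMeasure μ] (hπ : ∀ σ, MeasurableSet {x | π x = σ})
    (hW : ∀ i, Measurable (W i)) (hD : ∀ i, Measurable (D i))
    (h : IsMatchedPairAssignment π W D μ) :
    IndepFun (fun ω i => W i ω) (pairTreatment π W D) μ := by
  have hS : Measurable fun ω i => ((W i ω).1, (W i ω).2.1) :=
    measurable_pi_lambda _ fun i => (hW i).fst.prodMk (hW i).snd.fst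
  have hX := measurable_covVec hW
  have hZ := measurable_pairTreatment hπ hW hD
  have key : IndepFun (fun ω => ((fun i => ((W i ω).1, (W i ω).2.1)), covVec W ω))
      (pairTreatment π W D) μ := by
    rw [IndepFun_iff_Indep]
    refine IndepSets.indep
      (p1 := Set.preimage (fun ω => ((fun i => ((W i ω).1, (W i ω).2.1)), covVec W ω)) ''
        (Set.image2 (· ×ˢ ·) {s | MeasurableSet s} {t | MeasurableSet t}))
      (p2 := Set.preimage (pairTreatment π W D) '' (Set.range fun T => Set.univ.pi T))
      (hS.prodMk hX).comap_le hZ.comap_le (isPiSystem_prod.comap _)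
      (isPiSystem_range_univ_pi.comap _) ?_ ?_ ?_
    · rw [← MeasurableSpace.comap_generateFrom, generateFrom_prod]
    · rw [← MeasurableSpace.comap_generateFrom]
      congr 1
      -- On a finite space every set is a union of singletons, and each singleton is a box.
      refine le_antisymm (fun s _ => ?_) (MeasurableSpace.generateFrom_le fun s _ =>
        (Set.toFinite s).measurableSet)
      have : s = ⋃ z ∈ s, {z} := by simp
      rw [this]
      refine MeasurableSet.biUnion (Set.toFinite s).countable fun z _ =>
        MeasurableSpace.measurableSet_generateFrom ⟨fun j => {z j}, ?_⟩
      simp [Set.univ_pi_singleton]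
    · rw [IndepSets_iff]
      rintro _ _ ⟨_, ⟨A, hA, C, hC, rfl⟩, rfl⟩ ⟨_, ⟨T, rfl⟩, rfl⟩
      have h1 := measure_inter_pairTreatment hπ hW hD h hA hC T
      have h2 := measure_inter_pairTreatment hπ hW hD h MeasurableSet.univ MeasurableSet.univ T
      simp only [Set.preimage_univ, Set.univ_inter, probReal_univ, one_mul] at h2
      rw [← h2] at h1
      rw [← ENNReal.toReal_eq_toReal_iff' (measure_ne_top _ _)
        (ENNReal.mul_ne_top (measure_ne_top _ _) (measure_ne_top _ _)), ENNReal.toReal_mul]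
      exact h1
  -- Outcomes, responses and covariates are reassembled into units.
  have he : Measurable fun (r : (Fin (2 * m) → (Bool → ℝ) × (Bool → Bool))
      × (Fin (2 * m) → EuclideanSpace ℝ (Fin k))) (i : Fin (2 * m)) =>
        (((r.1 i).1, (r.1 i).2, r.2 i) : UnitData k) := by
    refine measurable_pi_lambda _ fun i => ?_
    fun_prop
  exact key.comp he measurable_id

/-- The joint law of the sample and of the treatments of the first units of the pairs. -/
lemma map_sample_prodMk [IsProbabilityMeasure μ] {Q : Measure (UnitData k)}
    [IsProbabilityMeasure Q] (hπ : ∀ σ, MeasurableSet {x | π x = σ})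
    (hW : ∀ i, Measurable (W i)) (hD : ∀ i, Measurable (D i))
    (h : IsMatchedPairAssignment π W D μ) (hlaw : ∀ i, μ.map (W i) = Q) (hind : iIndepFun W μ) :
    μ.map (fun ω => ((fun i => W i ω), fun j => (pairTreatment π W D ω j).1))
      = (Measure.pi fun _ => Q).prod (μ.map fun ω j => (pairTreatment π W D ω j).1) := by
  have hf : Measurable fun (z : Fin m → Bool × Bool) j => (z j).1 := by fun_prop
  have hWm : Measurable fun ω i => W i ω := measurable_pi_lambda _ fun i => hW i
  have hZ := measurable_pairTreatment hπ hW hD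
  have h1 : IndepFun (fun ω i => W i ω) (fun ω j => (pairTreatment π W D ω j).1) μ :=
    (indepFun_pairTreatment hπ hW hD h).comp measurable_id hf
  have h2 : Measurable fun ω j => (pairTreatment π W D ω j).1 := hf.comp hZ
  rw [(indepFun_iff_map_prod_eq_prod_map_map hWm.aemeasurable h2.aemeasurable).1 h1]
  congr 1
  rw [(iIndepFun_iff_map_fun_eq_pi_map fun i => (hW i).aemeasurable).1 hind]
  simp_rw [hlaw]

lemma ae_pairTreatment [IsProbabilityMeasure μ] (hπ : ∀ σ, MeasurableSet {x | π x = σ})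
    (hW : ∀ i, Measurable (W i)) (hD : ∀ i, Measurable (D i))
    (h : IsMatchedPairAssignment π W D μ) :
    ∀ᵐ ω ∂μ, ∀ j, (pairTreatment π W D ω j).2 = !(pairTreatment π W D ω j).1 := by
  have hZ := measurable_pairTreatment hπ hW hD
  refine ae_all_iff.2 fun j => ?_
  have h1 : ∀ᵐ z ∂(Measure.pi fun _ : Fin m => fairPair), (z j).2 = !(z j).1 :=
    (measurePreserving_eval (fun _ : Fin m => fairPair) j).quasiMeasurePreserving.ae ae_fairPair
  rw [← map_pairTreatment hπ hW hD h] at h1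
  exact ae_of_ae_map hZ.aemeasurable h1

lemma integral_sgn_mul_sgn [IsProbabilityMeasure μ] (hπ : ∀ σ, MeasurableSet {x | π x = σ})
    (hW : ∀ i, Measurable (W i)) (hD : ∀ i, Measurable (D i))
    (h : IsMatchedPairAssignment π W D μ) {j j' : Fin m} (hj : j ≠ j') :
    ∫ b, sgn (b j) * sgn (b j') ∂(μ.map fun ω j => (pairTreatment π W D ω j).1) = 0 := by
  have hf : Measurable fun (z : Fin m → Bool × Bool) j => (z j).1 := by fun_prop
  have hZ := measurable_pairTreatment hπ hW hD
  have hs : Measurable fun z : Bool × Bool => sgn z.1 := measurable_of_finite _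
  have h1 : (μ.map fun ω j => (pairTreatment π W D ω j).1)
      = (Measure.pi fun _ : Fin m => fairPair).map fun z j => (z j).1 := by
    rw [← map_pairTreatment hπ hW hD h, Measure.map_map hf hZ]; rfl
  rw [h1, integral_map hf.aemeasurable (measurable_of_finite _).aestronglyMeasurable]
  have hind : IndepFun (fun z : Fin m → Bool × Bool => sgn (z j).1) (fun z => sgn (z j').1)
      (Measure.pi fun _ => fairPair) :=
    (iIndepFun_pi (μ := fun _ : Fin m => fairPair) (X := fun _ z => sgn z.1)
      fun _ => hs.aemeasurable).indepFun hj
  rw [hind.integral_fun_mul_eq_mul_integral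
    (hs.comp (measurable_pi_apply j)).aestronglyMeasurable
    (hs.comp (measurable_pi_apply j')).aestronglyMeasurable,
    integral_comp_eval (μ := fun _ : Fin m => fairPair) (i := j)
      (f := fun z : Bool × Bool => sgn z.1) hs.aestronglyMeasurable, integral_sgn_fairPair,
    zero_mul]

end Assignment

/-! ## Pair fixed effects -/

section FixedEffects

variable {m : ℕ} {σ : Equiv.Perm (Fin (2 * m))} {Y R D : Fin (2 * m) → ℝ}

lemma sum_fixedEffects_fstPos (δ : Fin m → ℝ) (j : Fin m) :
    ∑ l, δ l * (if σ (fstPos j) = σ (fstPos l) ∨ σ (fstPos j) = σ (sndPos l) then 1 else 0)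
      = δ j := by
  rw [Finset.sum_eq_single j]
  · simp
  · intro l _ hl
    rw [if_neg, mul_zero]
    simp only [σ.injective.eq_iff, fstPos, sndPos, Fin.mk.injEq, not_or]
    exact ⟨fun h => hl (Fin.ext (by omega)), by omega⟩
  · simp

lemma sum_fixedEffects_sndPos (δ : Fin m → ℝ) (j : Fin m) :
    ∑ l, δ l * (if σ (sndPos j) = σ (fstPos l) ∨ σ (sndPos j) = σ (sndPos l) then 1 else 0)
      = δ j := by
  rw [Finset.sum_eq_single j]
  · simp
  · intro l _ hl
    rw [if_neg, mul_zero]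
    simp only [σ.injective.eq_iff, fstPos, sndPos, Fin.mk.injEq, not_or]
    exact ⟨by omega, fun h => hl (Fin.ext (by omega))⟩
  · simp

lemma pairFERss_eq (b : ℝ) (δ : Fin m → ℝ) :
    pairFERss σ Y R D b δ = ∑ j,
      ((if R (σ (fstPos j)) = 1 then (Y (σ (fstPos j)) - b * D (σ (fstPos j)) - δ j) ^ 2 else 0)
      + (if R (σ (sndPos j)) = 1 then (Y (σ (sndPos j)) - b * D (σ (sndPos j)) - δ j) ^ 2
        else 0)) := by
  rw [pairFERss, ← Equiv.sum_comp σ, sum_fstPos_add_sndPos]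
  refine Finset.sum_congr rfl fun j _ => ?_
  rw [sum_fixedEffects_fstPos, sum_fixedEffects_sndPos]

/-- The residual sum of squares after minimizing over the fixed effects. -/
noncomputable def profileRss (σ : Equiv.Perm (Fin (2 * m))) (Y R D : Fin (2 * m) → ℝ) (b : ℝ) : ℝ :=
  ∑ j, R (σ (fstPos j)) * R (σ (sndPos j))
    * ((Y (σ (fstPos j)) - Y (σ (sndPos j))) * (D (σ (fstPos j)) - D (σ (sndPos j))) - b) ^ 2 / 2

variable (hR : ∀ i, R i = 0 ∨ R i = 1)
  (hD : ∀ j, (D (σ (fstPos j)) - D (σ (sndPos j))) ^ 2 = 1)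

include hR hD

/-- In a complete pair the effect cancels from the difference of the two residuals, and `(a - c)² /
2 ≤ a² + c²`. Other pairs contribute zero on the left. -/
lemma profileRss_le (b : ℝ) (δ : Fin m → ℝ) :
    profileRss σ Y R D b ≤ pairFERss σ Y R D b δ := by
  rw [pairFERss_eq]
  refine Finset.sum_le_sum fun j _ => ?_
  have h := hD j
  generalize D (σ (fstPos j)) = d₁ at *
  generalize D (σ (sndPos j)) = d₂ at *
  generalize Y (σ (fstPos j)) = y₁ at *
  generalize Y (σ (sndPos j)) = y₂ at *
  rcases hR (σ (fstPos j)) with h1 | h1 <;> rcases hR (σ (sndPos j)) with h2 | h2 <;>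
    simp only [h1, h2, zero_ne_one, if_true, if_false, zero_mul, mul_zero, zero_div, one_mul,
      add_zero, zero_add, le_refl]
  · positivity
  · positivity
  -- Since `d₁ - d₂` is a sign, multiplying by it does not change the square.
  · have e : ((y₁ - y₂) * (d₁ - d₂) - b) ^ 2 = ((y₁ - b * d₁ - δ j) - (y₂ - b * d₂ - δ j)) ^ 2 := by
      linear_combination ((y₁ - y₂) ^ 2 - b ^ 2) * h
    rw [e]
    nlinarith [sq_nonneg ((y₁ - b * d₁ - δ j) + (y₂ - b * d₂ - δ j))]

lemma exists_pairFERss_eq (b : ℝ) :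
    ∃ δ : Fin m → ℝ, pairFERss σ Y R D b δ = profileRss σ Y R D b := by
  -- The optimal effect is the mean of `Y - b D` over the responding members of the pair; if there
  -- are none, any value will do.
  refine ⟨fun j => if R (σ (fstPos j)) = 1 then
    (if R (σ (sndPos j)) = 1 then ((Y (σ (fstPos j)) - b * D (σ (fstPos j)))
      + (Y (σ (sndPos j)) - b * D (σ (sndPos j)))) / 2 else Y (σ (fstPos j)) - b * D (σ (fstPos j)))
    else Y (σ (sndPos j)) - b * D (σ (sndPos j)), ?_⟩
  rw [pairFERss_eq]
  refine Finset.sum_congr rfl fun j _ => ?_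
  have h := hD j
  generalize D (σ (fstPos j)) = d₁ at *
  generalize D (σ (sndPos j)) = d₂ at *
  generalize Y (σ (fstPos j)) = y₁ at *
  generalize Y (σ (sndPos j)) = y₂ at *
  rcases hR (σ (fstPos j)) with h1 | h1 <;> rcases hR (σ (sndPos j)) with h2 | h2 <;>
    simp only [h1, h2, zero_ne_one, if_true, if_false, zero_mul, mul_zero, zero_div, one_mul,
      add_zero, sub_self, zero_pow two_ne_zero]
  linear_combination (b ^ 2 / 2 - (y₁ - y₂) ^ 2 / 2) * h

lemma isPairFECoefficient_iff_profileRss (b : ℝ) :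
    IsPairFECoefficient σ Y R D b ↔ ∀ b', profileRss σ Y R D b ≤ profileRss σ Y R D b' := by
  constructor
  · rintro ⟨δ, h⟩ b'
    obtain ⟨δ', h'⟩ := exists_pairFERss_eq (Y := Y) hR hD b'
    exact (profileRss_le hR hD b δ).trans ((h b' δ').trans h'.le)
  · intro h
    obtain ⟨δ, hδ⟩ := exists_pairFERss_eq (Y := Y) hR hD b
    exact ⟨δ, fun b' δ' => hδ.le.trans ((h b').trans (profileRss_le hR hD b' δ'))⟩

/-- If some pair is complete, the pair-fixed-effects coefficient is unique, and it is the
drop-pairs estimator. -/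
lemma isPairFECoefficient_iff (hc : completePairs σ R ≠ 0) (b : ℝ) :
    IsPairFECoefficient σ Y R D b ↔ b = dropPairs σ Y R D := by
  have hpos : 0 < completePairs σ R := by
    refine lt_of_le_of_ne (Finset.sum_nonneg fun j _ => ?_) hc.symm
    rcases hR (σ (fstPos j)) with h1 | h1 <;> rcases hR (σ (sndPos j)) with h2 | h2 <;>
      simp [h1, h2]
  have hS : ∑ j, R (σ (fstPos j)) * R (σ (sndPos j)) * (Y (σ (fstPos j)) - Y (σ (sndPos j)))
      * (D (σ (fstPos j)) - D (σ (sndPos j))) = completePairs σ R * dropPairs σ Y R D := by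
    rw [dropPairs, mul_inv_cancel_left₀ hc]
  -- The profile is a quadratic in `c` with leading coefficient half the number of complete pairs;
  -- this completes the square.
  have key : ∀ c, profileRss σ Y R D c = profileRss σ Y R D (dropPairs σ Y R D)
      + completePairs σ R / 2 * (c - dropPairs σ Y R D) ^ 2 := by
    intro c
    have e : ∀ c, profileRss σ Y R D c
        = (∑ j, R (σ (fstPos j)) * R (σ (sndPos j)) * ((Y (σ (fstPos j)) - Y (σ (sndPos j)))
            * (D (σ (fstPos j)) - D (σ (sndPos j)))) ^ 2 / 2)
          - c * (∑ j, R (σ (fstPos j)) * R (σ (sndPos j))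
            * (Y (σ (fstPos j)) - Y (σ (sndPos j))) * (D (σ (fstPos j)) - D (σ (sndPos j))))
          + c ^ 2 / 2 * completePairs σ R := by
      intro c
      rw [profileRss, completePairs, Finset.mul_sum, Finset.mul_sum, ← Finset.sum_sub_distrib,
        ← Finset.sum_add_distrib]
      exact Finset.sum_congr rfl fun j _ => by ring
    rw [e c, e (dropPairs σ Y R D), hS]
    ring
  rw [isPairFECoefficient_iff_profileRss hR hD]
  constructor
  · intro h
    have h1 := h (dropPairs σ Y R D)
    rw [key b] at h1
    have h2 : (b - dropPairs σ Y R D) ^ 2 ≤ 0 := by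
      by_contra hcon
      push Not at hcon
      have : 0 < completePairs σ R / 2 * (b - dropPairs σ Y R D) ^ 2 := by positivity
      linarith
    have h3 : b - dropPairs σ Y R D = 0 := by
      have := le_antisymm h2 (sq_nonneg _)
      exact pow_eq_zero_iff two_ne_zero |>.1 this
    linarith
  · rintro rfl b'
    rw [key b']
    have : 0 ≤ completePairs σ R / 2 * (b' - dropPairs σ Y R D) ^ 2 := by positivity
    linarith

end FixedEffects

/-! ## The estimators as sums over the pairs -/

section Estimators

variable {k m : ℕ} {π : (Fin (2 * m) → EuclideanSpace ℝ (Fin k)) → Equiv.Perm (Fin (2 * m))}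
  {w : Fin (2 * m) → UnitData k} {d : Fin (2 * m) → Bool} {b : Fin m → Bool}

lemma obsR_eq (w : UnitData k) (d : Bool) : obsR w d = potR d w := by
  cases d <;> simp [obsR, ind]

lemma potR_eq_zero_or_one (d : Bool) (w : UnitData k) : potR d w = 0 ∨ potR d w = 1 := by
  unfold potR ind
  split_ifs <;> simp

lemma obsY_eq (w : UnitData k) (d : Bool) : obsY w d = potYR d w := by
  rw [obsY, obsR_eq]
  cases d <;> simp [potYR, ind]

lemma potYR_mul_potR (d : Bool) (w : UnitData k) : potYR d w * potR d w = potYR d w := by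
  rcases potR_eq_zero_or_one d w with h | h <;> simp [potYR, h]

variable (h₁ : ∀ j, d (π (fun i => covX (w i)) (fstPos j)) = b j)
  (h₂ : ∀ j, d (π (fun i => covX (w i)) (sndPos j)) = !b j)

include h₁ h₂

lemma treatment_pick (s : Bool) (j : Fin m) : d (pick π s w b j) = s := by
  unfold pick slot
  split_ifs with h
  · rw [h₁, h]
  · rw [h₂]
    revert h
    cases b j <;> cases s <;> simp

lemma diffInMeans_eq : diffInMeans (fun i => obsY (w i) (d i)) (fun i => obsR (w i) (d i))
      (fun i => ind (d i))
    = (∑ j, potYR true (w (pick π true w b j))) / (∑ j, potR true (w (pick π true w b j)))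
      - (∑ j, potYR false (w (pick π false w b j)))
        / (∑ j, potR false (w (pick π false w b j))) := by
  have ht := treatment_pick h₁ h₂
  unfold diffInMeans
  rw [sum_pick (π := π) true w b (fun i => obsY (w i) (d i) * obsR (w i) (d i) * ind (d i)),
    sum_pick (π := π) true w b (fun i => obsR (w i) (d i) * ind (d i)),
    sum_pick (π := π) true w b (fun i => obsY (w i) (d i) * obsR (w i) (d i) * (1 - ind (d i))),
    sum_pick (π := π) true w b (fun i => obsR (w i) (d i) * (1 - ind (d i)))]
  simp [ht, obsY_eq, obsR_eq, potYR_mul_potR, ind]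

lemma completePairs_eq : completePairs (π fun i => covX (w i)) (fun i => obsR (w i) (d i))
    = ∑ j, potR true (w (pick π true w b j)) * potR false (w (pick π false w b j)) := by
  refine Finset.sum_congr rfl fun j _ => ?_
  simp only [h₁, h₂, obsR_eq, pick, slot]
  cases b j <;> simp [mul_comm]

/-- The factor `D - D` orients every pair as treated minus control. -/
lemma dropPairs_eq : dropPairs (π fun i => covX (w i)) (fun i => obsY (w i) (d i))
      (fun i => obsR (w i) (d i)) (fun i => ind (d i))
    = (∑ j, potYR true (w (pick π true w b j)) * potR false (w (pick π false w b j))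
        - ∑ j, potYR false (w (pick π false w b j)) * potR true (w (pick π true w b j)))
      / ∑ j, potR true (w (pick π true w b j)) * potR false (w (pick π false w b j)) := by
  rw [dropPairs, completePairs_eq h₁ h₂, inv_mul_eq_div, ← Finset.sum_sub_distrib]
  congr 1
  refine Finset.sum_congr rfl fun j _ => ?_
  simp only [h₁, h₂, obsR_eq, obsY_eq, pick, slot]
  have e : ∀ (s t : Bool) (u v : UnitData k), potR s u * potR t v * (potYR s u - potYR t v)
      = potYR s u * potR t v - potYR t v * potR s u := fun s t u v => by
    linear_combination potR t v * potYR_mul_potR s u - potR s u * potYR_mul_potR t v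
  cases b j
  · simp only [Bool.false_eq_true, if_false, if_true, Bool.not_false, ind, e]
    ring
  · simp only [Bool.true_eq_false, if_false, if_true, Bool.not_true, ind, e, Bool.false_eq_true]
    ring

end Estimators

/-! ## Limits in probability -/

/-- The model space changes with `m`, but a first absolute moment depends only on the law, so
convergence in mean transfers to the common space `Ω`. -/
lemma tendstoInMeasure_comp_of_map_eq {Ω : Type*} [MeasurableSpace Ω] {μ : Measure Ω}
    {E : ℕ → Type*} [∀ m, MeasurableSpace (E m)] {V : ∀ m, Ω → E m} (hV : ∀ m, Measurable (V m))
    {P : ∀ m, Measure (E m)} (hP : ∀ m, μ.map (V m) = P m) {F : ∀ m, E m → ℝ}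
    (hF : ∀ m, Integrable (F m) (P m))
    (h : Tendsto (fun m => ∫ p, |F m p| ∂(P m)) atTop (𝓝 0)) :
    TendstoInMeasure μ (fun m ω => F m (V m ω)) atTop (fun _ => 0) := by
  refine tendstoInMeasure_of_tendsto_integral_abs (fun m => ?_) ?_
  · have := hF m
    rw [← hP m] at this
    exact this.comp_measurable (hV m)
  · refine h.congr fun m => ?_
    have := (hF m).abs.aestronglyMeasurable
    rw [← hP m] at this ⊢
    exact integral_map (hV m).aemeasurable this

section Limits

variable {Ω : Type*} [MeasurableSpace Ω] {μ : Measure Ω} {k : ℕ} {Q : Measure (UnitData k)}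
  [IsProbabilityMeasure Q]
  {ν : (m : ℕ) → Measure (Fin m → Bool)} [∀ m, IsProbabilityMeasure (ν m)]
  {π : (m : ℕ) → (Fin (2 * m) → EuclideanSpace ℝ (Fin k)) → Equiv.Perm (Fin (2 * m))}
  {V : (m : ℕ) → Ω → (Fin (2 * m) → UnitData k) × (Fin m → Bool)}

/-- The average of a function over the units with treatment `s` converges to its mean. -/
lemma tendstoInMeasure_mean_pick (hV : ∀ m, Measurable (V m))
    (hP : ∀ m, μ.map (V m) = (Measure.pi fun _ => Q).prod (ν m))
    (hπ : ∀ m σ, MeasurableSet {x | π m x = σ})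
    (hν : ∀ m (j j' : Fin m), j ≠ j' → ∫ b, sgn (b j) * sgn (b j') ∂(ν m) = 0) (s : Bool)
    {q : UnitData k → ℝ} (hq : Integrable q Q) :
    TendstoInMeasure μ
      (fun (m : ℕ) ω => (m : ℝ)⁻¹ * ∑ j, q ((V m ω).1 (pick (π m) s (V m ω).1 (V m ω).2 j)))
      atTop (fun _ => ∫ w, q w ∂Q) := by
  have h1 := tendstoInMeasure_comp_of_map_eq hV hP (fun m => integrable_mean_unit m hq)
    (tendsto_integral_abs_mean_unit hq)
  have h2 := tendstoInMeasure_comp_of_map_eq hV hP (fun m => integrable_mean_pick_sub hπ s m hq)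
    (tendsto_integral_abs_mean_pick_sub hπ hν s hq)
  -- If `S` and `S'` are the arm averages, then `x = S + S' - 2 ∫ q` and `y = S - S'`, so the
  -- expression is `S`.
  have h3 := tendstoInMeasure_comp₂ (F := fun x y => (x + y) / 2 + ∫ w, q w ∂Q)
    (by fun_prop) h1 h2
  simp only [add_zero, zero_div, zero_add] at h3
  refine h3.congr' ?_ EventuallyEq.rfl
  -- At `m = 0` the two sides differ: they are `∫ q` and 0.
  filter_upwards [eventually_gt_atTop 0] with m hm
  refine Eventually.of_forall fun ω => ?_
  have hm' : (m : ℝ) ≠ 0 := by positivity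
  simp only
  rw [Finset.sum_sub_distrib, sum_pick (π := π m) s (V m ω).1 (V m ω).2
    (fun i => q ((V m ω).1 i)), Finset.sum_add_distrib, Finset.sum_sub_distrib]
  simp only [Finset.sum_const, Finset.card_univ, Fintype.card_fin, nsmul_eq_mul]
  push_cast
  field_simp
  ring

/-- The average of a product within the pairs converges to the mean of the product of the
conditional means, if the pairs are close and the first conditional mean is Lipschitz. -/
lemma tendstoInMeasure_mean_pick_mul_pick (hV : ∀ m, Measurable (V m))
    (hP : ∀ m, μ.map (V m) = (Measure.pi fun _ => Q).prod (ν m))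
    (hπ : ∀ m σ, MeasurableSet {x | π m x = σ})
    (hν : ∀ m (j j' : Fin m), j ≠ j' → ∫ b, sgn (b j) * sgn (b j') ∂(ν m) = 0)
    (hclose : ∀ s, TendstoInMeasure μ (fun (m : ℕ) ω => (m : ℝ)⁻¹ * ∑ j,
      ‖covX ((V m ω).1 (pick (π m) s (V m ω).1 (V m ω).2 j))
        - covX ((V m ω).1 (pick (π m) (!s) (V m ω).1 (V m ω).2 j))‖) atTop (fun _ => 0))
    (s : Bool) {f h : UnitData k → ℝ} (hf : Integrable f Q) (hLip : HasLipschitzCondMean Q f)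
    (hh : Measurable h) (hh1 : ∀ w, |h w| ≤ 1) :
    TendstoInMeasure μ
      (fun (m : ℕ) ω => (m : ℝ)⁻¹ * ∑ j, f ((V m ω).1 (pick (π m) s (V m ω).1 (V m ω).2 j))
        * h ((V m ω).1 (pick (π m) (!s) (V m ω).1 (V m ω).2 j)))
      atTop (fun _ => ∫ w, condX Q f w * condX Q h w ∂Q) := by
  obtain ⟨K, g, hg, hfg⟩ := hLip
  have hb := ae_abs_condX_le (Q := Q) hh1
  have hq : Integrable (fun w => condX Q f w * condX Q h w) Q :=
    (integrable_condX f).mul_bdd (c := 1) (measurable_condX h).aestronglyMeasurable hb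
  have h1 := tendstoInMeasure_comp_of_map_eq hV hP
    (fun m => integrable_mean_pick_mul_pick hπ s m hf hh hh1)
    (tendsto_integral_abs_mean_pick_mul_pick hπ s hf hh hh1)
  have h2 := tendstoInMeasure_mean_pick hV hP hπ hν (!s) hq
  -- Only the conditional mean of `f` is moved to the partner, so only its Lipschitz version is
  -- needed; that of `h` is just bounded by 1.
  have h3 : TendstoInMeasure μ (fun (m : ℕ) ω => (m : ℝ)⁻¹ * ∑ j,
      (condX Q f ((V m ω).1 (pick (π m) s (V m ω).1 (V m ω).2 j))
        - condX Q f ((V m ω).1 (pick (π m) (!s) (V m ω).1 (V m ω).2 j)))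
        * condX Q h ((V m ω).1 (pick (π m) (!s) (V m ω).1 (V m ω).2 j))) atTop (fun _ => 0) := by
    have hK := tendstoInMeasure_comp₂ (F := fun x _ => K * x) (by fun_prop) (hclose s) (hclose s)
    simp only [mul_zero] at hK
    refine tendstoInMeasure_zero_of_abs_le hK fun m => ?_
    have ha : ∀ᵐ p ∂(μ.map (V m)), (∀ i, condX Q f (p.1 i) = g (covX (p.1 i)))
        ∧ ∀ i, |condX Q h (p.1 i)| ≤ 1 := by
      rw [hP m]
      exact (ae_forall_unit hfg).and (ae_forall_unit hb)
    filter_upwards [ae_of_ae_map (hV m).aemeasurable ha] with ω hω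
    rw [abs_mul, abs_of_nonneg (by positivity : (0 : ℝ) ≤ (m : ℝ)⁻¹), mul_left_comm]
    refine mul_le_mul_of_nonneg_left ?_ (by positivity)
    rw [Finset.mul_sum]
    refine (Finset.abs_sum_le_sum_abs _ _).trans (Finset.sum_le_sum fun j _ => ?_)
    rw [abs_mul, hω.1, hω.1]
    refine (mul_le_of_le_one_right (abs_nonneg _) (hω.2 _)).trans ?_
    have := hg.dist_le_mul (covX ((V m ω).1 (pick (π m) s (V m ω).1 (V m ω).2 j)))
      (covX ((V m ω).1 (pick (π m) (!s) (V m ω).1 (V m ω).2 j)))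
    rwa [Real.dist_eq, dist_eq_norm] at this
  have h4 := tendstoInMeasure_comp₂ (F := fun x y => x + y) (by fun_prop) h1 h3
  have h5 := tendstoInMeasure_comp₂ (F := fun x y => x + y) (by fun_prop) h4 h2
  simp only [zero_add] at h5
  refine h5.congr_left fun m => Eventually.of_forall fun ω => ?_
  simp only
  rw [← mul_add, ← mul_add, ← Finset.sum_add_distrib, ← Finset.sum_add_distrib]
  congr 1
  exact Finset.sum_congr rfl fun j _ => by ring

end Limits

/-! ### The two forms of `θ^obs`, and integrability of `R(d)` and `Y(d) R(d)` -/

lemma thetaObs_eq_meanGivenResponse {k : ℕ} (Q : Measure (UnitData k)) :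
    thetaObs Q = meanGivenResponse Q true - meanGivenResponse Q false := by
  have hm : ∀ d, MeasurableSet {w : UnitData k | potR d w = 1} := fun d => by
    have : Measurable (potR d : UnitData k → ℝ) :=
      (measurable_of_finite ind).comp ((measurable_pi_apply d).comp (measurable_snd.fst))
    exact this (measurableSet_singleton 1)
  have hi : ∀ (d : Bool) (w : UnitData k),
      potR d w = {w | potR d w = 1}.indicator (fun _ => (1 : ℝ)) w := fun d w => by
    rcases potR_eq_zero_or_one d w with h | h
    · rw [Set.indicator_of_notMem (by simp [h]), h]
    · rw [Set.indicator_of_mem (s := {w | potR d w = 1}) h, h]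
  have h1 : ∀ d, ∫ w, potR d w ∂Q = Q.real {w | potR d w = 1} := fun d => by
    rw [← integral_indicator_one (hm d)]
    exact integral_congr_ae (Eventually.of_forall (hi d))
  have h2 : ∀ d, ∫ w, potR d w * potY d w ∂Q = ∫ w in {w | potR d w = 1}, potY d w ∂Q :=
    fun d => by
      rw [← integral_indicator (hm d)]
      refine integral_congr_ae (Eventually.of_forall fun w => ?_)
      rcases potR_eq_zero_or_one d w with h | h
      · simp only [h, zero_mul]
        rw [Set.indicator_of_notMem (by simp [h])]
      · simp only [h, one_mul]
        rw [Set.indicator_of_mem (s := {w | potR d w = 1}) h]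
  have h3 : ∀ d, meanGivenResponse Q d
      = (∫ w, potR d w * potY d w ∂Q) / ∫ w, potR d w ∂Q := fun d => by
    rw [meanGivenResponse, ProbabilityTheory.cond, integral_smul_measure, h1, h2,
      ENNReal.toReal_inv, smul_eq_mul, inv_mul_eq_div]
    rfl
  rw [h3, h3, thetaObs]

lemma measurable_potR {k : ℕ} (d : Bool) : Measurable (potR d : UnitData k → ℝ) :=
  (measurable_of_finite ind).comp ((measurable_pi_apply d).comp (measurable_snd.fst))

lemma abs_potR_le {k : ℕ} (d : Bool) (w : UnitData k) : |potR d w| ≤ 1 := by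
  rcases potR_eq_zero_or_one d w with h | h <;> simp [h]

lemma integrable_potR {k : ℕ} {Q : Measure (UnitData k)} [IsFiniteMeasure Q] (d : Bool) :
    Integrable (potR d) Q :=
  Integrable.of_bound (measurable_potR d).aestronglyMeasurable 1
    (Eventually.of_forall (abs_potR_le d))

lemma integrable_potYR {k : ℕ} {Q : Measure (UnitData k)} {d : Bool}
    (h : Integrable (potY d) Q) : Integrable (potYR d) Q :=
  h.mul_bdd (c := 1) (measurable_potR d).aestronglyMeasurable (Eventually.of_forall (abs_potR_le d))

/-- A sequence that agrees with `f`, unless a sequence with a nonzero limit vanishes, has the same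
limit as `f`. -/
lemma tendstoInMeasure_of_eq_of_ne_zero {Ω : Type*} [MeasurableSpace Ω] {μ : Measure Ω}
    {f T N : ℕ → Ω → ℝ} {a c : ℝ} (hf : TendstoInMeasure μ f atTop (fun _ => a))
    (hN : TendstoInMeasure μ N atTop (fun _ => c)) (hc : 0 < c)
    (h : ∀ m, ∀ᵐ ω ∂μ, N m ω ≠ 0 → T m ω = f m ω) :
    TendstoInMeasure μ T atTop (fun _ => a) := by
  rw [tendstoInMeasure_iff_dist] at hf hN ⊢
  intro ε hε
  have hsum := (hf ε hε).add (hN c hc)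
  rw [add_zero] at hsum
  refine tendsto_of_tendsto_of_tendsto_of_le_of_le tendsto_const_nhds hsum
    (fun _ => zero_le) fun m => ?_
  refine (measure_mono_ae ?_).trans (measure_union_le _ _)
  filter_upwards [h m] with ω hω hle
  -- Where `N` vanishes it is at distance exactly `c` from its limit, an event of vanishing measure.
  by_cases h0 : N m ω = 0
  · right
    change c ≤ dist (N m ω) c
    rw [h0, Real.dist_eq, zero_sub, abs_neg, abs_of_pos hc]
  · left
    change ε ≤ dist (f m ω) a
    rw [← hω h0]
    exact hle

end MatchedPair

theorem mainTheorem1 {Ω : Type*} [MeasurableSpace Ω] (μ : Measure Ω) [IsProbabilityMeasure μ]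
    (k : ℕ)
    -- the law of one unit
    (Q : Measure (MatchedPair.UnitData k)) [IsProbabilityMeasure Q]
    (hY : ∀ d, Integrable (MatchedPair.potY d) Q)
    (hR : ∀ d, 0 < ∫ w, MatchedPair.potR d w ∂Q)
    (hLipR : ∀ d, MatchedPair.HasLipschitzCondMean Q (MatchedPair.potR d))
    (hLipYR : ∀ d, MatchedPair.HasLipschitzCondMean Q (MatchedPair.potYR d))
    -- for each `m`, a sample of `2m` units, i.i.d. with law `Q`
    (W : (m : ℕ) → Fin (2 * m) → Ω → MatchedPair.UnitData k)
    (hWmeas : ∀ m i, Measurable (W m i))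
    (hWlaw : ∀ m i, μ.map (W m i) = Q)
    (hWindep : ∀ m, iIndepFun (W m) μ)
    -- the pairing, a measurable function of the covariates
    (π : (m : ℕ) → (Fin (2 * m) → EuclideanSpace ℝ (Fin k)) → Equiv.Perm (Fin (2 * m)))
    (hπ : ∀ m σ, MeasurableSet {x | π m x = σ})
    -- the treatments
    (D : (m : ℕ) → Fin (2 * m) → Ω → Bool)
    (hDmeas : ∀ m i, Measurable (D m i))
    (hD : ∀ m, MatchedPair.IsMatchedPairAssignment (π m) (W m) (D m) μ)
    (hclose : TendstoInMeasure μ (fun m ω => MatchedPair.avgPairDistance (π m) (W m) ω)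
      atTop (fun _ => 0)) :
    -- the difference in means, and the two forms of its limit
    TendstoInMeasure μ
        (fun m ω => MatchedPair.diffInMeans (MatchedPair.sampleY (W m) (D m) ω)
          (MatchedPair.sampleR (W m) (D m) ω) (MatchedPair.sampleD (D m) ω))
        atTop (fun _ => MatchedPair.thetaObs Q)
    ∧ MatchedPair.thetaObs Q
        = MatchedPair.meanGivenResponse Q true - MatchedPair.meanGivenResponse Q false
    -- the drop-pairs estimator is the pair-fixed-effects estimator, if some pair is complete
    ∧ (∀ m, ∀ᵐ ω ∂μ,
        MatchedPair.completePairs (π m (MatchedPair.covVec (W m) ω))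
            (MatchedPair.sampleR (W m) (D m) ω) ≠ 0 →
          ∀ b : ℝ, MatchedPair.IsPairFECoefficient (π m (MatchedPair.covVec (W m) ω))
              (MatchedPair.sampleY (W m) (D m) ω) (MatchedPair.sampleR (W m) (D m) ω)
              (MatchedPair.sampleD (D m) ω) b
            ↔ b = MatchedPair.dropPairs (π m (MatchedPair.covVec (W m) ω))
                (MatchedPair.sampleY (W m) (D m) ω) (MatchedPair.sampleR (W m) (D m) ω)
                (MatchedPair.sampleD (D m) ω))
    -- both converge to the drop estimand, if its denominator is not zero
    ∧ (0 < MatchedPair.dropDenom Q →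
        TendstoInMeasure μ
          (fun m ω => MatchedPair.dropPairs (π m (MatchedPair.covVec (W m) ω))
            (MatchedPair.sampleY (W m) (D m) ω) (MatchedPair.sampleR (W m) (D m) ω)
            (MatchedPair.sampleD (D m) ω))
          atTop (fun _ => MatchedPair.thetaDrop Q)
        ∧ ∀ T : ℕ → Ω → ℝ,
            (∀ m, ∀ᵐ ω ∂μ, MatchedPair.IsPairFECoefficient (π m (MatchedPair.covVec (W m) ω))
              (MatchedPair.sampleY (W m) (D m) ω) (MatchedPair.sampleR (W m) (D m) ω)
              (MatchedPair.sampleD (D m) ω) (T m ω)) →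
            TendstoInMeasure μ T atTop (fun _ => MatchedPair.thetaDrop Q)) := by
  open MatchedPair in
  have hZm : ∀ m, Measurable (pairTreatment (π m) (W m) (D m)) := fun m =>
    measurable_pairTreatment (hπ m) (hWmeas m) (hDmeas m)
  have hB : ∀ m, Measurable fun ω j => (pairTreatment (π m) (W m) (D m) ω j).1 := fun m =>
    (by fun_prop : Measurable fun (z : Fin m → Bool × Bool) j => (z j).1).comp (hZm m)
  let V : (m : ℕ) → Ω → (Fin (2 * m) → UnitData k) × (Fin m → Bool) := fun m ω =>
    ((fun i => W m i ω), fun j => (pairTreatment (π m) (W m) (D m) ω j).1)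
  let ν : (m : ℕ) → Measure (Fin m → Bool) := fun m =>
    μ.map fun ω j => (pairTreatment (π m) (W m) (D m) ω j).1
  have hV : ∀ m, Measurable (V m) := fun m =>
    (measurable_pi_lambda _ fun i => hWmeas m i).prodMk (hB m)
  have hνp : ∀ m, IsProbabilityMeasure (ν m) := fun m =>
    Measure.isProbabilityMeasure_map (hB m).aemeasurable
  have hP : ∀ m, μ.map (V m) = (Measure.pi fun _ => Q).prod (ν m) := fun m =>
    map_sample_prodMk (hπ m) (hWmeas m) (hDmeas m) (hD m) (hWlaw m) (hWindep m)
  have hν : ∀ m (j j' : Fin m), j ≠ j' → ∫ b, sgn (b j) * sgn (b j') ∂(ν m) = 0 :=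
    fun m j j' hj => integral_sgn_mul_sgn (hπ m) (hWmeas m) (hDmeas m) (hD m) hj
  have htreat : ∀ m, ∀ᵐ ω ∂μ,
      (∀ j, D m (π m (fun i => covX ((V m ω).1 i)) (fstPos j)) ω = (V m ω).2 j)
      ∧ ∀ j, D m (π m (fun i => covX ((V m ω).1 i)) (sndPos j)) ω = !(V m ω).2 j := fun m => by
    filter_upwards [ae_pairTreatment (hπ m) (hWmeas m) (hDmeas m) (hD m)] with ω hω
    exact ⟨fun j => rfl, hω⟩
  have hclose' : ∀ s, TendstoInMeasure μ (fun (m : ℕ) ω => (m : ℝ)⁻¹ * ∑ j,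
      ‖covX ((V m ω).1 (pick (π m) s (V m ω).1 (V m ω).2 j))
        - covX ((V m ω).1 (pick (π m) (!s) (V m ω).1 (V m ω).2 j))‖) atTop (fun _ => 0) := by
    intro s
    -- The factor 2 converts `1/(2m)` into `1/m`; the order within a pair does not matter, as the
    -- norm is symmetric.
    have h2 := tendstoInMeasure_comp₂ (F := fun x _ => 2 * x) (by fun_prop) hclose hclose
    rw [mul_zero] at h2
    refine h2.congr_left fun m => Eventually.of_forall fun ω => ?_
    simp only [avgPairDistance]
    rw [← mul_assoc]
    congr 1
    · push_cast
      rw [one_div, mul_inv, mul_inv_cancel_left₀ two_ne_zero]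
    · refine Finset.sum_congr rfl fun j _ => ?_
      unfold pick slot
      by_cases hs : (V m ω).2 j = s
      · rw [if_pos hs, if_neg (by rw [hs]; cases s <;> simp)]
        rfl
      · rw [if_neg hs, if_pos (by revert hs; cases (V m ω).2 j <;> cases s <;> simp),
          norm_sub_rev]
        rfl
  have hscale : ∀ (m : ℕ) (x y : Fin m → ℝ),
      ((m : ℝ)⁻¹ * ∑ j, x j) / ((m : ℝ)⁻¹ * ∑ j, y j) = (∑ j, x j) / ∑ j, y j := by
    intro m x y
    rcases Nat.eq_zero_or_pos m with rfl | hm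
    · simp
    · exact mul_div_mul_left _ _ (by positivity)
  have hOLS : ∀ m, ∀ᵐ ω ∂μ, completePairs (π m (covVec (W m) ω)) (sampleR (W m) (D m) ω) ≠ 0 →
      ∀ b : ℝ, IsPairFECoefficient (π m (covVec (W m) ω)) (sampleY (W m) (D m) ω)
          (sampleR (W m) (D m) ω) (sampleD (D m) ω) b
        ↔ b = dropPairs (π m (covVec (W m) ω)) (sampleY (W m) (D m) ω) (sampleR (W m) (D m) ω)
          (sampleD (D m) ω) := by
    intro m
    filter_upwards [htreat m] with ω hω hc b
    refine isPairFECoefficient_iff (fun i => ?_) (fun j => ?_) hc b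
    · simp only [sampleR, obsR_eq]
      exact potR_eq_zero_or_one _ _
    · have e1 := hω.1 j
      have e2 := hω.2 j
      change (ind (D m (π m (fun i => covX ((V m ω).1 i)) (fstPos j)) ω)
        - ind (D m (π m (fun i => covX ((V m ω).1 i)) (sndPos j)) ω)) ^ 2 = 1
      rw [e1, e2]
      cases (V m ω).2 j <;> simp [ind]
  refine ⟨?_, thetaObs_eq_meanGivenResponse Q, hOLS, fun hden => ?_⟩
  · have hR' : ∀ d, ∫ w, potR d w ∂Q ≠ 0 := fun d => (hR d).ne'
    have hratio := fun d => tendstoInMeasure_comp₂ (F := fun x y => x / y)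
      (by
        refine ContinuousAt.div continuousAt_fst continuousAt_snd ?_
        exact hR' d)
      (tendstoInMeasure_mean_pick hV hP hπ hν d (integrable_potYR (hY d)))
      (tendstoInMeasure_mean_pick hV hP hπ hν d (integrable_potR d))
    have h1 := tendstoInMeasure_comp₂ (F := fun x y => x - y) (by fun_prop) (hratio true)
      (hratio false)
    have hθ : thetaObs Q = (∫ w, potYR true w ∂Q) / (∫ w, potR true w ∂Q)
        - (∫ w, potYR false w ∂Q) / ∫ w, potR false w ∂Q := by
      simp only [thetaObs, potYR, mul_comm]
    rw [hθ]
    refine h1.congr_left fun m => ?_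
    filter_upwards [htreat m] with ω hω
    simp only [hscale]
    exact (diffInMeans_eq hω.1 hω.2).symm
  · have hlim : ∀ s d d', TendstoInMeasure μ (fun (m : ℕ) ω => (m : ℝ)⁻¹ * ∑ j,
          potYR d ((V m ω).1 (pick (π m) s (V m ω).1 (V m ω).2 j))
          * potR d' ((V m ω).1 (pick (π m) (!s) (V m ω).1 (V m ω).2 j)))
        atTop (fun _ => ∫ w, condX Q (potYR d) w * condX Q (potR d') w ∂Q) := fun s d d' =>
      tendstoInMeasure_mean_pick_mul_pick hV hP hπ hν hclose' s (integrable_potYR (hY d))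
        (hLipYR d) (measurable_potR d') (abs_potR_le d')
    have hden' := tendstoInMeasure_mean_pick_mul_pick hV hP hπ hν hclose' true
      (integrable_potR true) (hLipR true) (measurable_potR false) (abs_potR_le false)
    have hnum := tendstoInMeasure_comp₂ (F := fun x y => x - y) (by fun_prop)
      (hlim true true false) (hlim false false true)
    have hquot := tendstoInMeasure_comp₂ (F := fun x y => x / y)
      (by
        refine ContinuousAt.div continuousAt_fst continuousAt_snd ?_
        exact hden.ne') hnum hden'
    have hdrop : TendstoInMeasure μ
          (fun m ω => dropPairs (π m (covVec (W m) ω)) (sampleY (W m) (D m) ω)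
            (sampleR (W m) (D m) ω) (sampleD (D m) ω)) atTop (fun _ => thetaDrop Q) := by
      refine hquot.congr_left fun m => ?_
      filter_upwards [htreat m] with ω hω
      rw [← mul_sub, ← Finset.sum_sub_distrib, hscale, Finset.sum_sub_distrib]
      exact (dropPairs_eq hω.1 hω.2).symm
    refine ⟨hdrop, fun T hT => ?_⟩
    -- The normalized number of complete pairs serves as the sequence `N`; off its zero set the
    -- coefficient is unique.
    refine tendstoInMeasure_of_eq_of_ne_zero hdrop hden' hden fun m => ?_
    filter_upwards [hOLS m, hT m, htreat m] with ω h1 h2 h3 hne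
    refine (h1 ?_ _).1 h2
    have h4 := completePairs_eq (d := fun i => D m i ω) h3.1 h3.2
    intro h5
    refine hne ?_
    rw [mul_eq_zero]
    right
    exact h4.symm.trans h5
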